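/- **Setting.** Fix $m\ge 1$. For each $n$ let $X_1,\dots,X_n$ (that is, $X_{n,1},\dots,X_{n,n}$) be independent random variables with values in a measurable space $\mathcal X$, $X_i\sim P_i=P_{n,i}$ (not necessarily identically distributed), let $a=a_n$ be a real weight function on $m$-tuples of indices and $h=h_n:\mathcal X^m\to\mathbb R$ a measurable kernel (no symmetry is assumed). Let $I_n^m$ be the set of $m$-tuples of pairwise distinct indices in $[n]=\{1,\dots,n\}$, and $$U_n=\frac{(n-m)!}{n!}\sum_{(i_1,\dots,i_m)\in I_n^m}a(i_1,\dots,i_m)\,h(X_{i_1},\dots,X_{i_m}),\qquad \sigma_n^2=\mathrm{Var}(U_n).$$ For $l\in[m]$ let $\pi_l(y;y_1,\dots,y_{m-1})=(y_1,\dots,y_{l-1},y,y_l,\dots,y_{m-1})$. Put $\theta(i_1,\dots,i_m)=\int h\,dP_{i_1}\cdots dP_{i_m}$, $f^{(l)}_{i_1,\dots,i_{m-1}}(x)=\int h\{\pi_l(x;y_1,\dots,y_{m-1})\}\,dP_{i_1}(y_1)\cdots dP_{i_{m-1}}(y_{m-1})$ and $$h_{1,i}(x)=\frac{(n-m)!}{(n-1)!}\sum_{i_1,\dots,i_{m-1}}\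 \sum_{l=1}^m a\{\pi_l(i;i_1,\dots,i_{m-1})\}\Big[f^{(l)}_{i_1,\dots,i_{m-1}}(x)-\theta\{\pi_l(i;i_1,\dots,i_{m-1})\}\Big],$$ the outer sum being over the tuples of pairwise distinct indices in $[n]\setminus\{i\}$. Let $V(n)=\mathrm{Var}\{n^{-1}\sum_{i=1}^n h_{1,i}(X_i)\}$. For $K\ge2$ and $q\ge 0$ let $A_{K,q}(n)$ be the average of $|a(\boldsymbol i^{(1)})\cdots a(\boldsymbol i^{(K)})|$ over all $(\boldsymbol i^{(1)},\dots,\boldsymbol i^{(K)})\in (I_n^m)^K$ whose $K$ index sets have at least $q$ indices in common (an average over the empty set is $0$). Let $$M_1(n)=\max_{\boldsymbol i,\boldsymbol j\in I_n^m}|\theta(\boldsymbol i)-\theta(\boldsymbol j)|,$$ $$M_2(n)=\max\Big|E\big[E\{h(X_{r_1},\dots,X_{r_m})h(X_{s_1},\dots,X_{s_m})\mid X_{k_p}\}\big]-E\big[E\{h(X_{k_1},\dots,X_{k_m})h(X_{s_1},\dots,X_{s_m})\mid X_{k_p}\}\big]\Big|,$$ the last maximum being over $p,q\in[m]$ and $\boldsymbol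 r,\boldsymbol s,\boldsymbol k\in I_n^m$ such that $\boldsymbol r$ and $\boldsymbol s$ have exactly the index $r_p=s_q$ in common, and $\boldsymbol k$ and $\boldsymbol s$ have exactly the index $k_p=s_q$ in common (a maximum over the empty set is $0$). **Theorem (consistency of the bootstrap variance).** Assume the conditions of the central limit theorem for $U_n$: for every $n$ there is $M(n)>0$ with $\max_{(i_1,\dots,i_m)\in I_n^m}E\{h(X_{i_1},\dots,X_{i_m})^4\}\le M(n)$, $V(n)>0$ for all large $n$, and $$n^{-2}V(n)^{-1}A_{2,2}(n)M(n)^{1/2}\to0,\qquad n^{-2}V(n)^{-3/2}A_{3,1}(n)M(n)^{3/4}\to0 .$$ Assume moreover: (i) (Bounded second moments of the von Mises type kernel, repeated indices standing for the same variable or for independent copies.) $$\limsup_{n\to\infty}\max_{1\le i_1,\dots,i_m\le n}E\{h(X_{i_1},\dots,X_{i_m})^2\}<\infty,$$ $$\limsup_{n\to\infty}\max_{l,\,j,\,(i_1,\dots,i_{m-1})}\int\!\!\int h\{\pi_l(x;y_1,\dots,y_{m-1})\}^2\,dP_{i_1}(y_1)\cdots dP_{i_{m-1}}(y_{m-1})\,dP_j(x)<\infty,$$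 where in the second line $l\in[m]$, $j\in[n]$, and $(i_1,\dots,i_{m-1})$ runs over the tuples of pairwise distinct indices in $[n]$ ($j$ may be one of them). (ii) (Control of heterogeneity.) $$\frac1n\sum_{i=1}^n\sum_{j=1}^n\Big\{\frac{h_{1,i}(X_j)}{n\sigma_n}\Big\}^2\xrightarrow{P}1,\qquad \frac1{n^2}\sum_{i=1}^n\Big\{\sum_{j=1}^n\frac{h_{1,i}(X_j)}{n\sigma_n}\Big\}^2\xrightarrow{P}0,$$ $$n^{-1}\sigma_n^{-2}A_{2,1}(n)\{M_1(n)^2+M_2(n)+n^{-1}\}\to0 .$$ Given $X_1,\dots,X_n$, let $X_1^*,\dots,X_n^*$ be i.i.d. draws from the empirical distribution of $X_1,\dots,X_n$, let $$U_n^*=\frac{(n-m)!}{n!}\sum_{(i_1,\dots,i_m)\in I_n^m}a(i_1,\dots,i_m)\,h(X^*_{i_1},\dots,X^*_{i_m}),$$ and let $\mathrm{Var}^*$ denote the conditional variance given $X_1,\dots,X_n$. Then $$\big|\mathrm{Var}^*(\sigma_n^{-1}U_n^*)-\mathrm{Var}(\sigma_n^{-1}U_n)\big|\xrightarrow{P}0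 .$$ -/

import Mathlib

open MeasureTheory ProbabilityTheory Filter
open scoped Topology ENNReal Nat

noncomputable section

namespace WeightedU

/-- `I_n^m`: the `m`-tuples of pairwise distinct indices in an `n`-element index set. -/
def distinctTuples (n m : ℕ) : Finset (Fin m → Fin n) :=
  Finset.univ.filter fun i => Function.Injective i

/-- `I_{n-1}^{m}(-i)`: the `m`-tuples of pairwise distinct indices, all different from `i`. -/
def distinctTuplesAvoiding {n : ℕ} (m : ℕ) (i : Fin n) : Finset (Fin m → Fin n) :=
  Finset.univ.filter fun j => Function.Injective j ∧ ∀ k, j k ≠ i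

/-- The `K`-tuples of elements of `I_n^m` that share at least `q` common indices. -/
def sharing (n m K q : ℕ) : Finset (Fin K → Fin m → Fin n) :=
  Finset.univ.filter fun t =>
    (∀ k, Function.Injective (t k)) ∧
      q ≤ (Finset.univ.filter fun c : Fin n => ∀ k, ∃ l, t k l = c).card

/-- The average weight `A_{K,q}(n)`. -/
def avgWeight {n m : ℕ} (a : (Fin m → Fin n) → ℝ) (K q : ℕ) : ℝ :=
  ((sharing n m K q).card : ℝ)⁻¹ * ∑ t ∈ sharing n m K q, |∏ k, a (t k)|

/-- The weighted U-statistic of degree `m` with weights `a` and kernel `h`, as a function of the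
sample `x`. -/
def uStat {𝒳 : Type*} {n m : ℕ} (a : (Fin m → Fin n) → ℝ) (h : (Fin m → 𝒳) → ℝ)
    (x : Fin n → 𝒳) : ℝ :=
  ((n - m)! : ℝ) / (n ! : ℝ) * ∑ i ∈ distinctTuples n m, a i * h (fun l => x (i l))

section Projection

variable {𝒳 : Type*} [MeasurableSpace 𝒳] {n d : ℕ}

/-- `θ(i₁,…,i_m) = ∫ h(y₁,…,y_m) dP_{i₁}(y₁) ⋯ dP_{i_m}(y_m)`. -/
def theta (Q : Fin n → Measure 𝒳) {m : ℕ} (h : (Fin m → 𝒳) → ℝ) (i : Fin m → Fin n) : ℝ :=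
  ∫ y, h y ∂Measure.pi fun l => Q (i l)

/-- `f^{(l)}_{i₁,…,i_{m-1}}(x)`, with `m = d + 1`: the point `x` stands in position `l`, the other
arguments are integrated against `P_{i₁}, …, P_{i_{m-1}}`. -/
def condKernel (Q : Fin n → Measure 𝒳) (h : (Fin (d + 1) → 𝒳) → ℝ) (l : Fin (d + 1))
    (i : Fin d → Fin n) (x : 𝒳) : ℝ :=
  ∫ y : Fin d → 𝒳, h (l.insertNth x y) ∂Measure.pi fun k => Q (i k)

/-- The first order expansion `h_{1,i}`, with `m = d + 1`. -/
def h1 (Q : Fin n → Measure 𝒳) (a : (Fin (d + 1) → Fin n) → ℝ) (h : (Fin (d + 1) → 𝒳) → ℝ)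
    (i : Fin n) (x : 𝒳) : ℝ :=
  ((n - (d + 1))! : ℝ) / ((n - 1)! : ℝ) *
    ∑ j ∈ distinctTuplesAvoiding d i, ∑ l : Fin (d + 1),
      a (l.insertNth i j) * (condKernel Q h l j x - theta Q h (l.insertNth i j))

/-- The empirical distribution of the points `x₁, …, x_n`. -/
def empirical (x : Fin n → 𝒳) : Measure 𝒳 :=
  (n : ℝ≥0∞)⁻¹ • ∑ j, Measure.dirac (x j)

/-- The conditional law of the bootstrap sample `(X₁*, …, X_n*)` given `X = x`: `n` independent
draws from the empirical distribution of `x`. -/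
def bootstrapLaw (x : Fin n → 𝒳) : Measure (Fin n → 𝒳) :=
  Measure.pi fun _ => empirical x

end Projection

section Sample

variable {Ω 𝒳 : Type*} [MeasurableSpace Ω] [MeasurableSpace 𝒳] {n : ℕ}

/-- The distributions `P_i` of the `X_i`. -/
def laws (P : Measure Ω) (X : Fin n → Ω → 𝒳) (i : Fin n) : Measure 𝒳 :=
  P.map (X i)

/-- `σ_n`, the standard deviation of the U-statistic. -/
def sigma (P : Measure Ω) (X : Fin n → Ω → 𝒳) {m : ℕ} (a : (Fin m → Fin n) → ℝ)
    (h : (Fin m → 𝒳) → ℝ) : ℝ :=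
  √(Var[fun ω => uStat a h (fun i => X i ω); P])

/-- `V(n)`, the variance of `n⁻¹ ∑ᵢ h_{1,i}(X_i)`. -/
def mainVar (P : Measure Ω) (X : Fin n → Ω → 𝒳) {d : ℕ} (a : (Fin (d + 1) → Fin n) → ℝ)
    (h : (Fin (d + 1) → 𝒳) → ℝ) : ℝ :=
  Var[fun ω => (n : ℝ)⁻¹ * ∑ i, h1 (laws P X) a h i (X i ω); P]

/-- `M₁(n)`, the largest difference of the means `θ` over pairs of tuples (`0` if there are none). -/
def meanGap (P : Measure Ω) (X : Fin n → Ω → 𝒳) {m : ℕ} (h : (Fin m → 𝒳) → ℝ) : ℝ :=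
  sSup {v : ℝ | ∃ i ∈ distinctTuples n m, ∃ j ∈ distinctTuples n m,
    v = |theta (laws P X) h i - theta (laws P X) h j|}

/-- `E[E{h(X_r) h(X_s) ∣ X_c}]`. -/
def crossMoment (P : Measure Ω) (X : Fin n → Ω → 𝒳) {m : ℕ} (h : (Fin m → 𝒳) → ℝ)
    (r s : Fin m → Fin n) (c : Fin n) : ℝ :=
  ∫ ω, (P[fun ω' => h (fun l => X (r l) ω') * h (fun l => X (s l) ω') |
    MeasurableSpace.comap (X c) inferInstance]) ω ∂P

/-- `M₂(n)`: the largest difference of the second moments above, over positions `p`, `q` and tuples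
`r`, `s`, `k` such that `r` and `s` have only `r_p = s_q` in common, and `k` and `s` have only
`k_p = s_q` in common (`0` if there are none). -/
def crossGap (P : Measure Ω) (X : Fin n → Ω → 𝒳) {m : ℕ} (h : (Fin m → 𝒳) → ℝ) : ℝ :=
  sSup {v : ℝ | ∃ p q : Fin m, ∃ r ∈ distinctTuples n m, ∃ s ∈ distinctTuples n m,
    ∃ k ∈ distinctTuples n m,
      Set.range r ∩ Set.range s = {r p} ∧ r p = s q ∧
      Set.range k ∩ Set.range s = {k p} ∧ k p = s q ∧
      v = |crossMoment P X h r s (k p) - crossMoment P X h k s (k p)|}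

end Sample

/-- Convergence in probability to a constant, for random variables `Z n` that may live on different
probability spaces. -/
def TendstoInProb {Ω : ℕ → Type*} [∀ n, MeasurableSpace (Ω n)] (P : ∀ n, Measure (Ω n))
    (Z : ∀ n, Ω n → ℝ) (c : ℝ) : Prop :=
  ∀ ε : ℝ, 0 < ε → Tendsto (fun n => P n {ω | ε ≤ |Z n ω - c|}) atTop (𝓝 0)

end WeightedU

end

open WeightedU

/-!
The variance of a weighted U-statistic is that of its first order projection `n⁻¹ ∑ h_{1,t}(X_t)`,
up to a remainder carried by the pairs of index tuples with at least two common indices. This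
comparison applies to the true laws and also, conditionally on the sample, to the bootstrap law,
where the projection has to be formed with the empirical distribution. Replacing the empirical
distribution by the true laws in that projection costs a mean-square gap. Written out over index
tuples, the expectation of the gap is `O(n⁻¹)` from tuples in special position, while in general
position each pair of kernels meeting at one index contributes at most `2 M₂`. What is left,
`n⁻² ∑ₜ Var*(h_{1,t}(X*)) / σ²`, is exactly the difference of the two heterogeneity sums and tends
to `1`.
-/

open scoped BigOperators

noncomputable section

namespace WeightedU

section SecondMoments

variable {α β : Type*} [MeasurableSpace α] [MeasurableSpace β] {μ : Measure α} {ν : Measure β}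
  {f g : α → ℝ} {C : ℝ}

/-- `f` is square integrable with `∫ f² dμ ≤ C`. Square integrability is part of the notion because
the Bochner integral of a non-integrable square is `0`. -/
def HasSecondMomentLE (f : α → ℝ) (C : ℝ) (μ : Measure α) : Prop :=
  MemLp f 2 μ ∧ ∫ x, f x ^ 2 ∂μ ≤ C

namespace HasSecondMomentLE

lemma of_lintegral_sq_le (hf : AEStronglyMeasurable f μ) (hC : 0 ≤ C)
    (hfC : ∫⁻ x, ENNReal.ofReal (f x ^ 2) ∂μ ≤ ENNReal.ofReal C) : HasSecondMomentLE f C μ := by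
  refine ⟨(memLp_two_iff_integrable_sq hf).2 ⟨hf.pow 2, ?_⟩, ?_⟩
  · rw [hasFiniteIntegral_iff_ofReal (ae_of_all _ fun x => sq_nonneg _)]
    exact hfC.trans_lt ENNReal.ofReal_lt_top
  · rw [integral_eq_lintegral_of_nonneg_ae (ae_of_all _ fun x => sq_nonneg _) (hf.pow 2)]
    exact ENNReal.toReal_le_of_le_ofReal hC hfC

lemma nonneg (hf : HasSecondMomentLE f C μ) : 0 ≤ C :=
  (integral_nonneg fun _ => sq_nonneg _).trans hf.2

lemma comp_iff {T : α → β} (hT : AEMeasurable T μ) {f : β → ℝ}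
    (hf : AEStronglyMeasurable f (μ.map T)) :
    HasSecondMomentLE (fun x => f (T x)) C μ ↔ HasSecondMomentLE f C (μ.map T) := by
  have hsq : ∫ y, f y ^ 2 ∂(μ.map T) = ∫ x, f (T x) ^ 2 ∂μ := integral_map hT (hf.pow 2)
  rw [HasSecondMomentLE, HasSecondMomentLE, memLp_map_measure_iff hf hT, hsq, Function.comp_def]

lemma sub (hf : HasSecondMomentLE f C μ) (hg : HasSecondMomentLE g C μ) :
    HasSecondMomentLE (fun x => f x - g x) (4 * C) μ := by
  refine ⟨hf.1.sub hg.1, ?_⟩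
  calc ∫ x, (f x - g x) ^ 2 ∂μ
      ≤ ∫ x, (2 * f x ^ 2 + 2 * g x ^ 2) ∂μ := by
        refine integral_mono (hf.1.sub hg.1).integrable_sq
          ((hf.1.integrable_sq.const_mul 2).add (hg.1.integrable_sq.const_mul 2)) fun x => ?_
        nlinarith [sq_nonneg (f x + g x)]
    _ = 2 * ∫ x, f x ^ 2 ∂μ + 2 * ∫ x, g x ^ 2 ∂μ := by
        rw [integral_add (hf.1.integrable_sq.const_mul 2) (hg.1.integrable_sq.const_mul 2),
          integral_const_mul, integral_const_mul]
    _ ≤ 4 * C := by linarith [hf.2, hg.2]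

lemma abs_integral_mul_le (hf : HasSecondMomentLE f C μ) (hg : HasSecondMomentLE g C μ) :
    |∫ x, f x * g x ∂μ| ≤ C := by
  calc |∫ x, f x * g x ∂μ|
      ≤ ∫ x, |f x * g x| ∂μ := abs_integral_le_integral_abs
    _ ≤ ∫ x, (f x ^ 2 + g x ^ 2) / 2 ∂μ := by
        refine integral_mono (hf.1.integrable_mul hg.1).abs
          ((hf.1.integrable_sq.add hg.1.integrable_sq).div_const 2) fun x => ?_
        simp only [abs_mul]
        nlinarith [sq_nonneg (|f x| - |g x|), sq_abs (f x), sq_abs (g x)]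
    _ = (∫ x, f x ^ 2 ∂μ + ∫ x, g x ^ 2 ∂μ) / 2 := by
        rw [integral_div, integral_add hf.1.integrable_sq hg.1.integrable_sq]
    _ ≤ C := by linarith [hf.2, hg.2]

lemma sub_integral [IsProbabilityMeasure μ] (hf : HasSecondMomentLE f C μ) :
    HasSecondMomentLE (fun x => f x - ∫ y, f y ∂μ) C μ := by
  refine ⟨hf.1.sub (memLp_const _), ?_⟩
  rw [← variance_eq_integral hf.1.aestronglyMeasurable.aemeasurable]
  exact (variance_le_expectation_sq hf.1.aestronglyMeasurable).trans hf.2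

lemma abs_covariance_le [IsProbabilityMeasure μ] (hf : HasSecondMomentLE f C μ)
    (hg : HasSecondMomentLE g C μ) : |cov[f, g; μ]| ≤ C :=
  hf.sub_integral.abs_integral_mul_le hg.sub_integral

lemma sq_integral_le [IsProbabilityMeasure μ] (hf : HasSecondMomentLE f C μ) :
    (∫ x, f x ∂μ) ^ 2 ≤ C := by
  have hvar := variance_eq_sub hf.1
  simp only [Pi.pow_apply] at hvar
  linarith [variance_nonneg f μ, hf.2]

lemma integral_prod_right [SFinite μ] [IsProbabilityMeasure ν] {F : α × β → ℝ}
    (hF : HasSecondMomentLE F C (μ.prod ν)) :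
    HasSecondMomentLE (fun x => ∫ y, F (x, y) ∂ν) C μ := by
  have hmeas : AEStronglyMeasurable (fun x => ∫ y, F (x, y) ∂ν) μ :=
    hF.1.aestronglyMeasurable.integral_prod_right'
  have hjensen : ∀ᵐ x ∂μ, (∫ y, F (x, y) ∂ν) ^ 2 ≤ ∫ y, F (x, y) ^ 2 ∂ν := by
    filter_upwards [hF.1.aestronglyMeasurable.prodMk_left, hF.1.integrable_sq.prod_right_ae]
      with x hx hx2
    exact sq_integral_le ⟨(memLp_two_iff_integrable_sq hx).2 hx2, le_rfl⟩
  have hinteg := hF.1.integrable_sq.integral_prod_left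
  have hsq : Integrable (fun x => (∫ y, F (x, y) ∂ν) ^ 2) μ := by
    refine hinteg.mono' (hmeas.pow 2) ?_
    simpa only [Real.norm_eq_abs, abs_sq] using hjensen
  refine ⟨(memLp_two_iff_integrable_sq hmeas).2 hsq, ?_⟩
  calc ∫ x, (∫ y, F (x, y) ∂ν) ^ 2 ∂μ
      ≤ ∫ x, ∫ y, F (x, y) ^ 2 ∂ν ∂μ := integral_mono_ae hsq hinteg hjensen
    _ = ∫ z, F z ^ 2 ∂(μ.prod ν) := (integral_prod _ hF.1.integrable_sq).symm
    _ ≤ C := hF.2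

end HasSecondMomentLE

lemma hasSecondMomentLE_sqrt_of_lintegral_pow_four_le [IsProbabilityMeasure μ]
    (hf : AEStronglyMeasurable f μ) (hC : 0 ≤ C)
    (hfC : ∫⁻ x, ENNReal.ofReal (f x ^ 4) ∂μ ≤ ENNReal.ofReal C) :
    HasSecondMomentLE f (√C) μ := by
  have hsq : HasSecondMomentLE (fun x => f x ^ 2) C μ :=
    .of_lintegral_sq_le (hf.pow 2) hC (by simpa only [← pow_mul] using hfC)
  exact ⟨(memLp_two_iff_integrable_sq hf).2 (hsq.1.integrable (by norm_num)),
    Real.le_sqrt_of_sq_le hsq.sq_integral_le⟩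

lemma sq_covariance_le_variance_mul_variance [IsProbabilityMeasure μ] (hf : MemLp f 2 μ)
    (hg : MemLp g 2 μ) : cov[f, g; μ] ^ 2 ≤ Var[f; μ] * Var[g; μ] := by
  have hquad : ∀ t : ℝ, 0 ≤ Var[f; μ] * (t * t) + 2 * cov[f, g; μ] * t + Var[g; μ] := by
    intro t
    have hvar := variance_fun_add (hf.const_mul t) hg
    rw [variance_const_mul, covariance_const_mul_left] at hvar
    linarith [variance_nonneg (fun x => t * f x + g x) μ]
  have hdiscrim := discrim_le_zero hquad
  rw [discrim] at hdiscrim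
  linarith

lemma abs_variance_sub_variance_le [IsProbabilityMeasure μ] (hf : MemLp f 2 μ)
    (hg : MemLp g 2 μ) :
    |Var[f; μ] - Var[g; μ]|
      ≤ Var[fun x => f x - g x; μ] + 2 * √(Var[fun x => f x - g x; μ] * Var[g; μ]) := by
  have hdiff : MemLp (fun x => f x - g x) 2 μ := hf.sub hg
  have hvar : Var[f; μ] - Var[g; μ]
      = Var[fun x => f x - g x; μ] + 2 * cov[fun x => f x - g x, g; μ] := by
    have := variance_fun_add hdiff hg
    simp only [sub_add_cancel] at this
    linarith
  rw [hvar]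
  refine (abs_add_le _ _).trans ?_
  rw [abs_of_nonneg (variance_nonneg _ _), abs_mul, abs_two]
  gcongr
  exact Real.abs_le_sqrt (sq_covariance_le_variance_mul_variance hdiff hg)

end SecondMoments

section InsertNth

variable {α β : Type*} {d : ℕ} {l : Fin (d + 1)} {t : α} {r : Fin d → α} {i : Fin (d + 1) → α}

lemma comp_insertNth (u : α → β) (l : Fin (d + 1)) (t : α) (r : Fin d → α) :
    (fun k => u ((l.insertNth t r : Fin (d + 1) → α) k)) = l.insertNth (u t) fun k => u (r k) := by
  ext k
  refine Fin.succAboveCases l ?_ (fun k => ?_) k <;> simp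

lemma insertNth_injective (hr : Function.Injective r) (ht : ∀ k, r k ≠ t) :
    Function.Injective (l.insertNth t r : Fin (d + 1) → α) := by
  intro a b
  refine Fin.succAboveCases l ?_ (fun a => ?_) a <;> refine Fin.succAboveCases l ?_ (fun b => ?_) b
  · simp
  · simpa using fun h => (ht b h.symm).elim
  · simpa using fun h => (ht a h).elim
  · simpa using fun h => hr h

lemma removeNth_injective (hi : Function.Injective i) : Function.Injective (l.removeNth i) :=
  fun _ _ hab => Fin.succAbove_right_injective (hi hab)

lemma removeNth_ne (hi : Function.Injective i) (k : Fin d) : l.removeNth i k ≠ i l :=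
  fun hab => Fin.succAbove_ne l k (hi hab)

lemma measurable_insertNth [MeasurableSpace α] [MeasurableSpace β] (l : Fin (d + 1)) {f : β → α}
    {g : β → Fin d → α} (hf : Measurable f) (hg : Measurable g) :
    Measurable fun z => (l.insertNth (f z) (g z) : Fin (d + 1) → α) :=
  (MeasurableEquiv.piFinSuccAbove (fun _ => α) l).symm.measurable.comp (hf.prodMk hg)

end InsertNth

section Meeting

variable {ι κ α : Type*} {i : ι → α} {j : κ → α} {p : ι} {q : κ}

/-- The tuples `i` and `j` share the entry `i p = j q` and nothing else. -/
def MeetAt (i : ι → α) (j : κ → α) (p : ι) (q : κ) : Prop :=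
  ∀ p' q', i p' = j q' ↔ p' = p ∧ q' = q

namespace MeetAt

lemma apply_eq (h : MeetAt i j p q) : i p = j q :=
  (h p q).2 ⟨rfl, rfl⟩

lemma symm (h : MeetAt i j p q) : MeetAt j i q p :=
  fun q' p' => by rw [eq_comm, h, and_comm]

lemma range_inter_range (h : MeetAt i j p q) : Set.range i ∩ Set.range j = {i p} := by
  ext c
  simp only [Set.mem_inter_iff, Set.mem_range, Set.mem_singleton_iff]
  constructor
  · rintro ⟨⟨p', rfl⟩, q', hq'⟩
    rw [((h p' q').1 hq'.symm).1]
  · rintro rfl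
    exact ⟨⟨p, rfl⟩, q, h.apply_eq.symm⟩

end MeetAt

lemma meetAt_insertNth {d : ℕ} {p q : Fin (d + 1)} {t : α} {r s : Fin d → α} (hr : ∀ k, r k ≠ t)
    (hs : ∀ k, s k ≠ t) (hrs : ∀ k k', r k ≠ s k') :
    MeetAt (p.insertNth t r : Fin (d + 1) → α) (q.insertNth t s : Fin (d + 1) → α) p q := by
  intro p' q'
  refine Fin.succAboveCases p ?_ (fun k => ?_) p' <;>
    refine Fin.succAboveCases q ?_ (fun k' => ?_) q'
  · simp
  · simpa using (hs k').symm
  · simpa using hr k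
  · simpa using hrs k k'

variable [Fintype ι] [Fintype κ] [DecidableEq α]

/-- The entries that the tuples `i` and `j` have in common. -/
def commonEntries (i : ι → α) (j : κ → α) : Finset α :=
  Finset.univ.image i ∩ Finset.univ.image j

lemma mem_commonEntries {c : α} : c ∈ commonEntries i j ↔ (∃ p, i p = c) ∧ ∃ q, j q = c := by
  simp [commonEntries]

lemma ne_of_card_commonEntries_eq_zero (h : (commonEntries i j).card = 0) (p : ι) (q : κ) :
    i p ≠ j q := by
  intro hpq
  have : i p ∈ commonEntries i j := mem_commonEntries.2 ⟨⟨p, rfl⟩, q, hpq.symm⟩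
  simp [Finset.card_eq_zero.1 h] at this

lemma exists_meetAt_of_card_commonEntries_eq_one (hi : Function.Injective i)
    (hj : Function.Injective j) (h : (commonEntries i j).card = 1) : ∃ p q, MeetAt i j p q := by
  obtain ⟨c, hc⟩ := Finset.card_eq_one.1 h
  obtain ⟨⟨p, rfl⟩, q, hq⟩ := mem_commonEntries.1 (hc ▸ Finset.mem_singleton_self c)
  refine ⟨p, q, fun p' q' => ⟨fun hpq => ?_, ?_⟩⟩
  · have hmem : i p' ∈ commonEntries i j := mem_commonEntries.2 ⟨⟨p', rfl⟩, q', hpq.symm⟩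
    rw [hc, Finset.mem_singleton] at hmem
    exact ⟨hi hmem, hj (hpq.symm.trans (hmem.trans hq.symm))⟩
  · rintro ⟨rfl, rfl⟩
    exact hq.symm

/-- The sum of `c p q` over the pairs of positions at which the tuples `i` and `j` agree. -/
def matchingSum (i : ι → α) (j : κ → α) (c : ι → κ → ℝ) : ℝ :=
  ∑ p, ∑ q, if i p = j q then c p q else 0

lemma matchingSum_eq_zero (h : ∀ p q, i p ≠ j q) (c : ι → κ → ℝ) : matchingSum i j c = 0 :=
  Finset.sum_eq_zero fun p _ => Finset.sum_eq_zero fun q _ => if_neg (h p q)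

lemma MeetAt.matchingSum_eq (h : MeetAt i j p q) (c : ι → κ → ℝ) :
    matchingSum i j c = c p q := by
  rw [matchingSum, Finset.sum_eq_single p _ (by simp),
    Finset.sum_eq_single q _ (by simp), if_pos h.apply_eq]
  · exact fun q' _ hq' => if_neg fun hpq => hq' ((h p q').1 hpq).2
  · exact fun p' _ hp' => Finset.sum_eq_zero fun q' _ => if_neg fun hpq => hp' ((h p' q').1 hpq).1

lemma abs_matchingSum_le {c : ι → κ → ℝ} {B : ℝ} (hc : ∀ p q, |c p q| ≤ B) :
    |matchingSum i j c| ≤ Fintype.card ι * Fintype.card κ * B := by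
  have hterm : ∀ p q, |if i p = j q then c p q else 0| ≤ B := by
    intro p q
    split_ifs
    · exact hc p q
    · simpa using (abs_nonneg _).trans (hc p q)
  calc |matchingSum i j c|
      ≤ ∑ p, ∑ q, |if i p = j q then c p q else 0| :=
        (Finset.abs_sum_le_sum_abs _ _).trans
          (Finset.sum_le_sum fun p _ => Finset.abs_sum_le_sum_abs _ _)
    _ ≤ ∑ _p : ι, ∑ _q : κ, B :=
        Finset.sum_le_sum fun p _ => Finset.sum_le_sum fun q _ => hterm p q
    _ = Fintype.card ι * Fintype.card κ * B := by simp [mul_assoc]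

end Meeting

section SharedWeight

variable {n m : ℕ}

lemma mem_distinctTuples {i : Fin m → Fin n} : i ∈ distinctTuples n m ↔ Function.Injective i := by
  simp [distinctTuples]

/-- `(n - m)! / n!`, the normalisation of the U-statistic; it is `1 / |I_n^m|` if `m ≤ n`. -/
def tupleRatio (n m : ℕ) : ℝ :=
  ((n - m)! : ℝ) / (n ! : ℝ)

/-- The total of the absolute weights `|a(i) a(j)|` over the pairs of tuples with at least `q`
common indices. It is normalised by the number of all pairs, whereas `A_{2,q}(n)` is normalised by
the number of the pairs that occur in the sum. -/
def sharedWeight (a : (Fin m → Fin n) → ℝ) (q : ℕ) : ℝ :=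
  tupleRatio n m ^ 2 * ∑ i ∈ distinctTuples n m, ∑ j ∈ distinctTuples n m,
    if q ≤ (commonEntries i j).card then |a i * a j| else 0

lemma sharedWeight_nonneg (a : (Fin m → Fin n) → ℝ) (q : ℕ) : 0 ≤ sharedWeight a q :=
  mul_nonneg (sq_nonneg _)
    (Finset.sum_nonneg fun i _ => Finset.sum_nonneg fun j _ => by split_ifs <;> positivity)

lemma sharedWeight_antitone (a : (Fin m → Fin n) → ℝ) : Antitone (sharedWeight a) := by
  intro q q' hqq'
  refine mul_le_mul_of_nonneg_left (Finset.sum_le_sum fun i _ =>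
    Finset.sum_le_sum fun j _ => ?_) (sq_nonneg _)
  split_ifs with hq' hq
  · exact le_rfl
  · exact absurd (hqq'.trans hq') hq
  · positivity
  · exact le_rfl

lemma mem_sharing_two {q : ℕ} {t : Fin 2 → Fin m → Fin n} :
    t ∈ sharing n m 2 q ↔ t 0 ∈ distinctTuples n m ∧ t 1 ∈ distinctTuples n m ∧
      q ≤ (commonEntries (t 0) (t 1)).card := by
  have hcommon : Finset.univ.filter (fun c => (∃ l, t 0 l = c) ∧ ∃ l, t 1 l = c)
      = commonEntries (t 0) (t 1) := by
    ext c
    simp [mem_commonEntries]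
  simp only [sharing, Finset.mem_filter, Finset.mem_univ, true_and, hcommon, Fin.forall_fin_two,
    mem_distinctTuples, and_assoc]

lemma sharedWeight_eq_sum_sharing (a : (Fin m → Fin n) → ℝ) (q : ℕ) :
    sharedWeight a q = tupleRatio n m ^ 2 * ∑ t ∈ sharing n m 2 q, |∏ k, a (t k)| := by
  classical
  rw [sharedWeight, ← Finset.sum_product', ← Finset.sum_filter]
  congr 1
  refine Finset.sum_equiv (finTwoArrowEquiv (Fin m → Fin n)).symm (fun z => ?_) fun z _ => ?_
  · simp [mem_sharing_two, and_assoc]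
  · simp [Fin.prod_univ_two]

lemma sharedWeight_eq_card_mul_avgWeight (a : (Fin m → Fin n) → ℝ) (q : ℕ) :
    sharedWeight a q = tupleRatio n m ^ 2 * (sharing n m 2 q).card * avgWeight a 2 q := by
  rw [sharedWeight_eq_sum_sharing, avgWeight, mul_assoc]
  rcases (sharing n m 2 q).eq_empty_or_nonempty with hempty | hne
  · simp [hempty]
  · rw [mul_inv_cancel_left₀ (by exact_mod_cast hne.card_pos.ne')]

lemma avgWeight_nonneg (a : (Fin m → Fin n) → ℝ) (K q : ℕ) : 0 ≤ avgWeight a K q :=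
  mul_nonneg (by positivity) (Finset.sum_nonneg fun _ _ => abs_nonneg _)

lemma abs_sum_sum_mul_le (a : (Fin m → Fin n) → ℝ) {D : (Fin m → Fin n) → (Fin m → Fin n) → ℝ}
    {B₁ B₂ : ℝ} (hB₁ : 0 ≤ B₁)
    (hdisjoint : ∀ i j, (∀ p q, i p ≠ j q) → Function.Injective i → Function.Injective j →
      D i j = 0)
    (hmeet : ∀ i j p q, MeetAt i j p q → Function.Injective i → Function.Injective j →
      |D i j| ≤ B₁)
    (hbound : ∀ i j, Function.Injective i → Function.Injective j → |D i j| ≤ B₂) :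
    |tupleRatio n m ^ 2 * ∑ i ∈ distinctTuples n m, ∑ j ∈ distinctTuples n m, a i * a j * D i j|
      ≤ B₁ * sharedWeight a 1 + B₂ * sharedWeight a 2 := by
  have hterm : ∀ i j, Function.Injective i → Function.Injective j → |a i * a j * D i j| ≤
      B₁ * (if 1 ≤ (commonEntries i j).card then |a i * a j| else 0)
        + B₂ * (if 2 ≤ (commonEntries i j).card then |a i * a j| else 0) := by
    intro i j hi hj
    rw [abs_mul, mul_comm]
    rcases (by omega : (commonEntries i j).card = 0 ∨ (commonEntries i j).card = 1 ∨
      2 ≤ (commonEntries i j).card) with h | h | h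
    · simp [h, hdisjoint i j (ne_of_card_commonEntries_eq_zero h) hi hj]
    · obtain ⟨p, q, hpq⟩ := exists_meetAt_of_card_commonEntries_eq_one hi hj h
      simpa [h] using mul_le_mul_of_nonneg_right (hmeet i j p q hpq hi hj) (abs_nonneg (a i * a j))
    · simp only [h, one_le_two.trans h, if_true]
      nlinarith [mul_le_mul_of_nonneg_right (hbound i j hi hj) (abs_nonneg (a i * a j)),
        mul_nonneg hB₁ (abs_nonneg (a i * a j))]
  rw [abs_mul, abs_of_nonneg (sq_nonneg _), sharedWeight, sharedWeight, mul_left_comm B₁,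
    mul_left_comm B₂, ← mul_add]
  refine mul_le_mul_of_nonneg_left ?_ (sq_nonneg _)
  simp only [Finset.mul_sum, ← Finset.sum_add_distrib]
  refine (Finset.abs_sum_le_sum_abs _ _).trans (Finset.sum_le_sum fun i hi => ?_)
  refine (Finset.abs_sum_le_sum_abs _ _).trans (Finset.sum_le_sum fun j hj => ?_)
  exact hterm i j (mem_distinctTuples.1 hi) (mem_distinctTuples.1 hj)

end SharedWeight

section Counting

variable {ι κ α : Type*} [Fintype ι] [Fintype α] [DecidableEq ι]

lemma card_filter_comp_eq_mul_le [Fintype κ] [DecidableEq α] {p : κ → ι}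
    (hp : Function.Injective p) (w : κ → α) :
    (Finset.univ.filter fun g : ι → α => g ∘ p = w).card * Fintype.card α ^ Fintype.card κ
      ≤ Fintype.card α ^ Fintype.card ι := by
  classical
  have hinj : Set.InjOn (fun z : (ι → α) × (κ → α) => Function.extend p z.2 z.1)
      ((Finset.univ.filter fun g : ι → α => g ∘ p = w) ×ˢ (Finset.univ : Finset (κ → α))) := by
    rintro ⟨g, x⟩ hg ⟨g', x'⟩ hg' heq
    simp only [Finset.coe_univ, Finset.coe_filter, Finset.mem_univ, true_and, Set.mem_prod,
      Set.mem_ofPred_eq, Set.mem_univ, and_true] at hg hg'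
    refine Prod.ext (funext fun b => ?_) (funext fun k => ?_)
    · by_cases hb : ∃ k, p k = b
      · obtain ⟨k, rfl⟩ := hb
        exact congrFun (hg.trans hg'.symm) k
      · simpa [Function.extend_apply' _ _ _ hb] using congrFun heq b
    · simpa [hp.extend_apply] using congrFun heq (p k)
  calc (Finset.univ.filter fun g : ι → α => g ∘ p = w).card * Fintype.card α ^ Fintype.card κ
      = ((Finset.univ.filter fun g : ι → α => g ∘ p = w)
          ×ˢ (Finset.univ : Finset (κ → α))).card := by simp
    _ ≤ (Finset.univ : Finset (ι → α)).card :=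
        Finset.card_le_card_of_injOn _ (by simp) (by simpa using hinj)
    _ = Fintype.card α ^ Fintype.card ι := by simp

lemma card_filter_apply_eq_apply_mul_le [DecidableEq α] {b c : ι} (hbc : b ≠ c) :
    (Finset.univ.filter fun g : ι → α => g b = g c).card * Fintype.card α
      ≤ Fintype.card α ^ Fintype.card ι := by
  have hinj : Set.InjOn (fun z : (ι → α) × α => Function.update z.1 b z.2)
      ((Finset.univ.filter fun g : ι → α => g b = g c) ×ˢ (Finset.univ : Finset α)) := by
    rintro ⟨g, x⟩ hg ⟨g', x'⟩ hg' heq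
    simp only [Finset.coe_univ, Finset.coe_filter, Finset.mem_univ, true_and, Set.mem_prod,
      Set.mem_ofPred_eq, Set.mem_univ, and_true] at hg hg'
    have hne : ∀ e, e ≠ b → g e = g' e := fun e he => by
      simpa [Function.update_of_ne he] using congrFun heq e
    refine Prod.ext (funext fun e => ?_) (by simpa using congrFun heq b)
    by_cases he : e = b
    · subst he
      exact (hg.trans (hne c hbc.symm)).trans hg'.symm
    · exact hne e he
  calc (Finset.univ.filter fun g : ι → α => g b = g c).card * Fintype.card α
      = ((Finset.univ.filter fun g : ι → α => g b = g c) ×ˢ (Finset.univ : Finset α)).card := by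
        simp
    _ ≤ (Finset.univ : Finset (ι → α)).card :=
        Finset.card_le_card_of_injOn _ (by simp) (by simpa using hinj)
    _ = Fintype.card α ^ Fintype.card ι := by simp

lemma card_filter_apply_eq_mul_le [DecidableEq α] (b : ι) (v : α) :
    (Finset.univ.filter fun g : ι → α => g b = v).card * Fintype.card α
      ≤ Fintype.card α ^ Fintype.card ι := by
  have h := card_filter_comp_eq_mul_le (Function.injective_of_subsingleton fun _ : Unit => b)
    fun _ => v
  simpa [funext_iff] using h

lemma card_filter_not_generic_mul_le [DecidableEq α] (S : Finset α) :
    (Finset.univ.filter fun g : ι → α => ¬ (Function.Injective g ∧ ∀ b, g b ∉ S)).card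
        * Fintype.card α
      ≤ (Fintype.card ι ^ 2 + Fintype.card ι * S.card) * Fintype.card α ^ Fintype.card ι := by
  have hcover : (Finset.univ.filter fun g : ι → α => ¬ (Function.Injective g ∧ ∀ b, g b ∉ S)) ⊆
      (Finset.univ.offDiag.biUnion fun z : ι × ι =>
        Finset.univ.filter fun g : ι → α => g z.1 = g z.2) ∪
      ((Finset.univ ×ˢ S).biUnion fun z : ι × α =>
        Finset.univ.filter fun g : ι → α => g z.1 = z.2) := by
    intro g hg
    simp only [Finset.mem_filter, Finset.mem_univ, true_and, not_and_or, Function.Injective,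
      not_forall, not_not] at hg
    simp only [Finset.mem_union, Finset.mem_biUnion, Finset.mem_filter, Finset.mem_univ, true_and,
      Finset.mem_offDiag, Finset.mem_product]
    rcases hg with ⟨b, c, hbc, hne⟩ | ⟨b, hb⟩
    · exact Or.inl ⟨(b, c), hne, hbc⟩
    · exact Or.inr ⟨(b, g b), hb, rfl⟩
  have hoffDiag : (Finset.univ : Finset ι).offDiag.card ≤ Fintype.card ι ^ 2 := by
    rw [Finset.offDiag_card, Finset.card_univ, sq]
    exact Nat.sub_le _ _
  refine (Nat.mul_le_mul_right _
    ((Finset.card_le_card hcover).trans (Finset.card_union_le _ _))).trans ?_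
  rw [add_mul, add_mul]
  refine add_le_add ?_ ?_
  · refine (Nat.mul_le_mul_right _ Finset.card_biUnion_le).trans ?_
    rw [Finset.sum_mul]
    refine (Finset.sum_le_card_nsmul _ _ (Fintype.card α ^ Fintype.card ι) fun z hz =>
      card_filter_apply_eq_apply_mul_le (Finset.mem_offDiag.1 hz).2.2).trans ?_
    exact Nat.mul_le_mul_right _ hoffDiag
  · refine (Nat.mul_le_mul_right _ Finset.card_biUnion_le).trans ?_
    rw [Finset.sum_mul]
    refine (Finset.sum_le_card_nsmul _ _ (Fintype.card α ^ Fintype.card ι) fun z _ =>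
      card_filter_apply_eq_mul_le z.1 z.2).trans ?_
    simp

lemma abs_expect_le_of_generic [Nonempty α] (S : Finset α) {F : (ι → α) → ℝ} {B C : ℝ}
    (hB : 0 ≤ B) (hall : ∀ g, |F g| ≤ C)
    (hgeneric : ∀ g, Function.Injective g → (∀ b, g b ∉ S) → |F g| ≤ B) :
    |𝔼 g, F g|
      ≤ B + C * (Fintype.card ι ^ 2 + Fintype.card ι * S.card) * (Fintype.card α : ℝ)⁻¹ := by
  classical
  have hα : (0 : ℝ) < Fintype.card α := by exact_mod_cast Fintype.card_pos
  have hC : 0 ≤ C := (abs_nonneg _).trans (hall fun _ => Classical.arbitrary α)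
  set bad := Finset.univ.filter fun g : ι → α => ¬ (Function.Injective g ∧ ∀ b, g b ∉ S)
    with hbad
  have hcard : (bad.card : ℝ) / Fintype.card (ι → α)
      ≤ (Fintype.card ι ^ 2 + Fintype.card ι * S.card) * (Fintype.card α : ℝ)⁻¹ := by
    rw [← div_eq_mul_inv, div_le_div_iff₀ (by exact_mod_cast Fintype.card_pos) hα,
      Fintype.card_fun]
    exact_mod_cast card_filter_not_generic_mul_le S
  have hterm : ∀ g, |F g| ≤ B + if g ∈ bad then C else 0 := by
    intro g
    by_cases hg : g ∈ bad
    · simpa [hg] using (hall g).trans (le_add_of_nonneg_left hB)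
    · simp only [hbad, Finset.mem_filter, Finset.mem_univ, true_and, not_not] at hg
      have := hgeneric g hg.1 hg.2
      split_ifs <;> linarith
  calc |𝔼 g, F g|
      ≤ 𝔼 g, (B + if g ∈ bad then C else 0) :=
        (Finset.abs_expect_le _ _).trans (Finset.expect_le_expect fun g _ => hterm g)
    _ = B + C * (bad.card / Fintype.card (ι → α)) := by
        rw [Finset.expect_add_distrib, Fintype.expect_const, Fintype.expect_eq_sum_div_card,
          Finset.sum_ite_mem, Finset.univ_inter, Finset.sum_const, nsmul_eq_mul]
        ring
    _ ≤ _ := by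
        rw [mul_assoc]
        gcongr

lemma card_sharing_two_mul_le (n m q : ℕ) :
    (sharing n m 2 q).card * n ^ q ≤ m ^ (2 * q) * n ^ (2 * m) := by
  classical
  have hcover : sharing n m 2 q ⊆
      (Finset.univ.filter fun z : (Fin m → Fin n) × (Fin q → Fin m) × (Fin q → Fin m) =>
        Function.Injective z.2.2).biUnion fun z =>
          (Finset.univ.filter fun g : Fin m → Fin n => g ∘ z.2.2 = z.1 ∘ z.2.1).image
            fun g => ![z.1, g] := by
    intro t ht
    obtain ⟨e⟩ : Nonempty (Fin q ↪ commonEntries (t 0) (t 1)) :=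
      Function.Embedding.nonempty_of_card_le (by simpa using (mem_sharing_two.1 ht).2.2)
    have hmem := fun k => mem_commonEntries.1 (e k).2
    choose p hp using fun k => (hmem k).1
    choose p' hp' using fun k => (hmem k).2
    simp only [Finset.mem_biUnion, Finset.mem_image, Finset.mem_filter, Finset.mem_univ, true_and]
    refine ⟨(t 0, p, p'), fun k k' hkk' => e.injective (Subtype.ext ?_), t 1, ?_, ?_⟩
    · rw [← hp' k, ← hp' k']
      exact congrArg (t 1) hkk'
    · exact funext fun k => (hp' k).trans (hp k).symm
    · ext k : 1
      fin_cases k <;> rfl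
  calc (sharing n m 2 q).card * n ^ q
      ≤ (∑ z ∈ Finset.univ.filter
          fun z : (Fin m → Fin n) × (Fin q → Fin m) × (Fin q → Fin m) => Function.Injective z.2.2,
          (Finset.univ.filter fun g : Fin m → Fin n => g ∘ z.2.2 = z.1 ∘ z.2.1).card) * n ^ q := by
        refine Nat.mul_le_mul_right _ ((Finset.card_le_card hcover).trans ?_)
        exact Finset.card_biUnion_le.trans (Finset.sum_le_sum fun z _ => Finset.card_image_le)
    _ ≤ (Finset.univ.filter fun z : (Fin m → Fin n) × (Fin q → Fin m) × (Fin q → Fin m) =>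
          Function.Injective z.2.2).card * n ^ m := by
        rw [Finset.sum_mul]
        refine Finset.sum_le_card_nsmul _ _ (n ^ m) fun z hz => ?_
        simpa using card_filter_comp_eq_mul_le (Finset.mem_filter.1 hz).2 (z.1 ∘ z.2.1)
    _ ≤ (n ^ m * (m ^ q * m ^ q)) * n ^ m := by
        refine Nat.mul_le_mul_right _ ((Finset.card_le_univ _).trans_eq ?_)
        simp
    _ = m ^ (2 * q) * n ^ (2 * m) := by ring

lemma tupleRatio_mul_pow_le {n m : ℕ} (hnm : 2 * m ≤ n) :
    tupleRatio n m * (n : ℝ) ^ m ≤ 2 ^ m := by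
  have hpow : n ^ m ≤ 2 ^ m * n.descFactorial m := by
    calc n ^ m ≤ (2 * (n + 1 - m)) ^ m := Nat.pow_le_pow_left (by omega) m
      _ = 2 ^ m * (n + 1 - m) ^ m := mul_pow _ _ _
      _ ≤ _ := Nat.mul_le_mul_left _ (Nat.pow_sub_le_descFactorial n m)
  have hfactorial : (n - m)! * n ^ m ≤ 2 ^ m * n ! := by
    rw [← Nat.factorial_mul_descFactorial (by omega : m ≤ n)]
    calc _ ≤ (n - m)! * (2 ^ m * n.descFactorial m) := Nat.mul_le_mul_left _ hpow
      _ = _ := by ring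
  rw [tupleRatio, div_mul_eq_mul_div, div_le_iff₀ (by positivity)]
  exact_mod_cast hfactorial

lemma sharedWeight_le {n m : ℕ} (hn : 0 < n) (hnm : 2 * m ≤ n) (a : (Fin m → Fin n) → ℝ) (q : ℕ) :
    sharedWeight a q ≤ 4 ^ m * m ^ (2 * q) * (((n : ℝ) ^ q)⁻¹ * avgWeight a 2 q) := by
  have hcard : ((sharing n m 2 q).card : ℝ) * (n : ℝ) ^ q ≤ m ^ (2 * q) * (n : ℝ) ^ (2 * m) := by
    exact_mod_cast card_sharing_two_mul_le n m q
  have hratio : tupleRatio n m ^ 2 * (sharing n m 2 q).card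
      ≤ 4 ^ m * m ^ (2 * q) * ((n : ℝ) ^ q)⁻¹ := by
    have hpos : 0 ≤ tupleRatio n m * (n : ℝ) ^ m := by
      rw [tupleRatio]
      positivity
    rw [le_mul_inv_iff₀ (by positivity)]
    calc tupleRatio n m ^ 2 * (sharing n m 2 q).card * (n : ℝ) ^ q
        ≤ tupleRatio n m ^ 2 * (m ^ (2 * q) * (n : ℝ) ^ (2 * m)) := by
          rw [mul_assoc]
          gcongr
      _ = (tupleRatio n m * (n : ℝ) ^ m) ^ 2 * m ^ (2 * q) := by ring
      _ ≤ (2 ^ m) ^ 2 * m ^ (2 * q) := by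
          gcongr
          exact tupleRatio_mul_pow_le hnm
      _ = 4 ^ m * m ^ (2 * q) := by rw [← pow_mul, mul_comm m 2, pow_mul]; norm_num
  rw [sharedWeight_eq_card_mul_avgWeight, ← mul_assoc]
  exact mul_le_mul_of_nonneg_right hratio (avgWeight_nonneg a 2 q)

end Counting

section Kernel

variable {Ω 𝒳 : Type*} {n : ℕ} (X : Fin n → Ω → 𝒳)

/-- The random variable `h(X_{i₁}, …, X_{i_m})`. -/
def kernelAt {m : ℕ} (h : (Fin m → 𝒳) → ℝ) (i : Fin m → Fin n) (ω : Ω) : ℝ :=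
  h fun k => X (i k) ω

lemma kernelAt_eq_insertNth {d : ℕ} (h : (Fin (d + 1) → 𝒳) → ℝ)
    (i : Fin (d + 1) → Fin n) (l : Fin (d + 1)) (ω : Ω) :
    kernelAt X h i ω = h (l.insertNth (X (i l) ω) fun k => X (l.removeNth i k) ω) := by
  rw [kernelAt, ← comp_insertNth fun t => X t ω, Fin.insertNth_self_removeNth]

end Kernel

section Projection

variable {Ω 𝒳 : Type*} [MeasurableSpace Ω] [MeasurableSpace 𝒳] {n d : ℕ}
  {P : Measure Ω} {X : Fin n → Ω → 𝒳}

lemma indepFun_subtuple {κ κ' : Type*} (hX : ∀ t, Measurable (X t)) (hind : iIndepFun X P)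
    {r : κ → Fin n} {s : κ' → Fin n} (hrs : ∀ k k', r k ≠ s k') :
    IndepFun (fun ω k => X (r k) ω) (fun ω k => X (s k) ω) P := by
  classical
  let S : Finset (Fin n) := {c | c ∈ Set.range r}
  let T : Finset (Fin n) := {c | c ∈ Set.range s}
  have hST : Disjoint S T := by
    rw [Finset.disjoint_left]
    simpa [S, T] using fun k k' => (hrs k k').symm
  have hrS : ∀ k, r k ∈ S := fun k => by simp [S]
  have hsT : ∀ k, s k ∈ T := fun k => by simp [T]
  have hr : Measurable fun (z : S → 𝒳) k => z ⟨r k, hrS k⟩ := by fun_prop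
  have hs : Measurable fun (z : T → 𝒳) k => z ⟨s k, hsT k⟩ := by fun_prop
  exact (hind.indepFun_finset S T hST hX).comp hr hs

variable [IsProbabilityMeasure P]

lemma integral_comp_eq_integral_integral_of_indepFun {β γ : Type*} [MeasurableSpace β]
    [MeasurableSpace γ] {Y : Ω → β} {Z : Ω → γ} (hY : Measurable Y) (hZ : Measurable Z)
    (hYZ : IndepFun Y Z P) {Φ : β → γ → ℝ} (hΦ : Measurable (Function.uncurry Φ))
    (hinteg : Integrable (fun ω => Φ (Y ω) (Z ω)) P) :
    ∫ ω, Φ (Y ω) (Z ω) ∂P = ∫ ω, ∫ y, Φ y (Z ω) ∂(P.map Y) ∂P := by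
  have := Measure.isProbabilityMeasure_map (μ := P) hY.aemeasurable
  have := Measure.isProbabilityMeasure_map (μ := P) hZ.aemeasurable
  have hlaw := (indepFun_iff_map_prod_eq_prod_map_map hY.aemeasurable hZ.aemeasurable).1 hYZ
  have hpair : AEMeasurable (fun ω => (Y ω, Z ω)) P := (hY.prodMk hZ).aemeasurable
  have hintprod : Integrable (Function.uncurry Φ) ((P.map Y).prod (P.map Z)) := by
    rw [← hlaw]
    exact (integrable_map_measure hΦ.aestronglyMeasurable hpair).2 hinteg
  calc ∫ ω, Φ (Y ω) (Z ω) ∂P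
      = ∫ z, Function.uncurry Φ z ∂(P.map fun ω => (Y ω, Z ω)) :=
        (integral_map hpair hΦ.aestronglyMeasurable).symm
    _ = ∫ z, ∫ y, Φ y z ∂(P.map Y) ∂(P.map Z) := by
        rw [hlaw, integral_prod_symm _ hintprod]
        rfl
    _ = ∫ ω, ∫ y, Φ y (Z ω) ∂(P.map Y) ∂P :=
        integral_map hZ.aemeasurable
          (StronglyMeasurable.integral_prod_left (f := Φ)
            hΦ.stronglyMeasurable).aestronglyMeasurable

lemma isProbabilityMeasure_laws (hX : ∀ t, Measurable (X t)) (t : Fin n) :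
    IsProbabilityMeasure (laws P X t) :=
  Measure.isProbabilityMeasure_map (hX t).aemeasurable

lemma map_subtuple {κ : Type*} [Fintype κ] (hX : ∀ t, Measurable (X t)) (hind : iIndepFun X P)
    {r : κ → Fin n} (hr : Function.Injective r) :
    P.map (fun ω k => X (r k) ω) = Measure.pi fun k => laws P X (r k) :=
  (iIndepFun_iff_map_fun_eq_pi_map fun k => (hX (r k)).aemeasurable).1 (hind.precomp hr)

lemma map_prodMk_subtuple (hX : ∀ t, Measurable (X t)) (hind : iIndepFun X P)
    {i : Fin (d + 1) → Fin n} (hi : Function.Injective i) (l : Fin (d + 1)) :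
    P.map (fun ω => (X (i l) ω, fun k => X (l.removeNth i k) ω))
      = (laws P X (i l)).prod (Measure.pi fun k => laws P X (l.removeNth i k)) := by
  have hindep : IndepFun (X (i l)) (fun ω k => X (l.removeNth i k) ω) P :=
    (indepFun_subtuple hX hind (r := fun _ : Unit => i l)
      fun _ k => (removeNth_ne hi k).symm).comp (measurable_pi_apply ()) measurable_id
  rw [← map_subtuple hX hind (removeNth_injective hi)]
  exact (indepFun_iff_map_prod_eq_prod_map_map (hX _).aemeasurable
    (measurable_pi_lambda _ fun k => hX _).aemeasurable).1 hindep

/-- The projection `f^{(l)}_{i₁,…,i_{l-1},i_{l+1},…,i_m}(X_{i_l})` of the kernel at the tuple `i` on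
the variable in position `l`. The index `i_l` may be one of the others; these stand for independent
copies. -/
def projAt (P : Measure Ω) (X : Fin n → Ω → 𝒳) (h : (Fin (d + 1) → 𝒳) → ℝ) (l : Fin (d + 1))
    (i : Fin (d + 1) → Fin n) (ω : Ω) : ℝ :=
  condKernel (laws P X) h l (l.removeNth i) (X (i l) ω)

variable {h : (Fin (d + 1) → 𝒳) → ℝ} {i j : Fin (d + 1) → Fin n}

lemma measurable_kernelAt (hX : ∀ t, Measurable (X t)) (hh : Measurable h)
    (i : Fin (d + 1) → Fin n) : Measurable (kernelAt X h i) :=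
  hh.comp (measurable_pi_lambda _ fun k => hX (i k))

lemma measurable_condKernel (Q : Fin n → Measure 𝒳) [∀ t, IsProbabilityMeasure (Q t)]
    (hh : Measurable h) (l : Fin (d + 1)) (r : Fin d → Fin n) :
    Measurable (condKernel Q h l r) :=
  (StronglyMeasurable.integral_prod_right (f := fun x y => h (l.insertNth x y))
    (hh.comp (measurable_insertNth l measurable_fst measurable_snd)).stronglyMeasurable).measurable

lemma hasSecondMomentLE_projAt (hX : ∀ t, Measurable (X t)) (hh : Measurable h) {C : ℝ}
    (l : Fin (d + 1))
    (hC : HasSecondMomentLE (fun z : 𝒳 × (Fin d → 𝒳) => h (l.insertNth z.1 z.2)) C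
      ((laws P X (i l)).prod (Measure.pi fun k => laws P X (l.removeNth i k)))) :
    HasSecondMomentLE (projAt P X h l i) C P := by
  have := fun t => isProbabilityMeasure_laws (P := P) hX t
  exact (HasSecondMomentLE.comp_iff (hX _).aemeasurable
    (measurable_condKernel _ hh _ _).aestronglyMeasurable).2 hC.integral_prod_right

lemma HasSecondMomentLE.projAt (hX : ∀ t, Measurable (X t)) (hind : iIndepFun X P)
    (hh : Measurable h) {C : ℝ} (hi : Function.Injective i)
    (hC : HasSecondMomentLE (kernelAt X h i) C P) (l : Fin (d + 1)) :
    HasSecondMomentLE (projAt P X h l i) C P := by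
  refine hasSecondMomentLE_projAt hX hh l ?_
  rw [← map_prodMk_subtuple hX hind hi]
  refine (HasSecondMomentLE.comp_iff (f := fun z => h (l.insertNth z.1 z.2))
    ((hX _).prodMk (measurable_pi_lambda _ fun k => hX _)).aemeasurable
    (hh.comp (measurable_insertNth l measurable_fst measurable_snd)).aestronglyMeasurable).1 ?_
  simpa only [← kernelAt_eq_insertNth] using hC

/-- The variables in the positions other than `l` are independent of the other factor, and can be
integrated out. -/
lemma integral_kernelAt_mul_eq {κ : Type*} (hX : ∀ t, Measurable (X t)) (hind : iIndepFun X P)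
    (hh : Measurable h) (hi : Function.Injective i) {l : Fin (d + 1)} {s : κ → Fin n} {q : κ}
    (hq : s q = i l) (his : ∀ k k', l.removeNth i k ≠ s k') {g : (κ → 𝒳) → ℝ} (hg : Measurable g)
    (hinteg : Integrable (fun ω => kernelAt X h i ω * g (fun k => X (s k) ω)) P) :
    ∫ ω, kernelAt X h i ω * g (fun k => X (s k) ω) ∂P
      = ∫ ω, projAt P X h l i ω * g (fun k => X (s k) ω) ∂P := by
  simp only [kernelAt_eq_insertNth X h i l, ← hq, projAt] at hinteg ⊢
  rw [integral_comp_eq_integral_integral_of_indepFun (Y := fun ω k => X (l.removeNth i k) ω)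
    (Z := fun ω k => X (s k) ω) (Φ := fun y z => h (l.insertNth (z q) y) * g z)
    (measurable_pi_lambda _ fun k => hX _) (measurable_pi_lambda _ fun k => hX _)
    (indepFun_subtuple hX hind his) ?_ hinteg, map_subtuple hX hind (removeNth_injective hi)]
  · simp only [integral_mul_const, condKernel]
  · refine (hh.comp (measurable_insertNth l ?_ measurable_fst)).mul (hg.comp measurable_snd)
    exact (measurable_pi_apply q).comp measurable_snd

lemma integral_kernelAt_eq_integral_projAt (hX : ∀ t, Measurable (X t)) (hind : iIndepFun X P)
    (hh : Measurable h) (hi : Function.Injective i) (l : Fin (d + 1))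
    (hinteg : Integrable (kernelAt X h i) P) :
    ∫ ω, kernelAt X h i ω ∂P = ∫ ω, projAt P X h l i ω ∂P := by
  simpa only [mul_one] using integral_kernelAt_mul_eq hX hind hh hi (s := fun _ : Unit => i l)
    (q := ()) rfl (fun k _ => removeNth_ne hi k) (measurable_const (a := 1))
    (by simpa only [mul_one] using hinteg)

lemma MeetAt.integral_kernelAt_mul_kernelAt {p q : Fin (d + 1)} (hij : MeetAt i j p q)
    (hX : ∀ t, Measurable (X t)) (hind : iIndepFun X P) (hh : Measurable h)
    (hi : Function.Injective i) (hHi : MemLp (kernelAt X h i) 2 P)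
    (hHj : MemLp (kernelAt X h j) 2 P) :
    ∫ ω, kernelAt X h i ω * kernelAt X h j ω ∂P
      = ∫ ω, projAt P X h p i ω * kernelAt X h j ω ∂P :=
  integral_kernelAt_mul_eq hX hind hh hi hij.apply_eq.symm
    (fun k _ hkk' => Fin.succAbove_ne p k ((hij _ _).1 hkk').1) hh (hHi.integrable_mul hHj)

lemma MeetAt.integral_projAt_mul_kernelAt {p q : Fin (d + 1)} (hij : MeetAt i j p q)
    (hX : ∀ t, Measurable (X t)) (hind : iIndepFun X P) (hh : Measurable h)
    (hj : Function.Injective j) (hFi : MemLp (projAt P X h p i) 2 P)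
    (hHj : MemLp (kernelAt X h j) 2 P) :
    ∫ ω, projAt P X h p i ω * kernelAt X h j ω ∂P
      = ∫ ω, projAt P X h p i ω * projAt P X h q j ω ∂P := by
  have := fun t => isProbabilityMeasure_laws (P := P) hX t
  have hcomm : ∀ G : Ω → ℝ, ∫ ω, projAt P X h p i ω * G ω ∂P
      = ∫ ω, G ω * condKernel (laws P X) h p (p.removeNth i) (X (j q) ω) ∂P := fun G => by
    simp only [projAt, hij.apply_eq, mul_comm]
  rw [hcomm, hcomm]
  refine integral_kernelAt_mul_eq hX hind hh hj (s := fun _ : Unit => j q) (q := ()) rfl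
    (fun k _ => removeNth_ne hj k) (g := fun z => condKernel _ h p (p.removeNth i) (z ()))
    ((measurable_condKernel _ hh _ _).comp (measurable_pi_apply ())) ?_
  have hinteg := hHj.integrable_mul hFi
  simp only [projAt, hij.apply_eq, Pi.mul_def] at hinteg
  exact hinteg

end Projection

section FirstOrderExpansion

variable {𝒳 : Type*} [MeasurableSpace 𝒳] {n d : ℕ}

lemma sum_distinctTuplesAvoiding (l : Fin (d + 1)) (t : Fin n)
    (F : (Fin (d + 1) → Fin n) → (Fin d → Fin n) → ℝ) :
    ∑ r ∈ distinctTuplesAvoiding d t, F (l.insertNth t r) r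
      = ∑ i ∈ distinctTuples n (d + 1), if i l = t then F i (l.removeNth i) else 0 := by
  rw [← Finset.sum_filter]
  refine Finset.sum_bij' (fun r _ => (l.insertNth t r : Fin (d + 1) → Fin n))
    (fun i _ => l.removeNth i) (fun r hr => ?_) (fun i hi => ?_) (fun r _ => ?_) (fun i hi => ?_)
    fun r _ => ?_
  · simp only [distinctTuplesAvoiding, Finset.mem_filter, Finset.mem_univ, true_and] at hr
    simpa [mem_distinctTuples] using insertNth_injective hr.1 hr.2
  · simp only [Finset.mem_filter, mem_distinctTuples] at hi
    simpa [distinctTuplesAvoiding, ← hi.2] using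
      And.intro (removeNth_injective (l := l) hi.1) (removeNth_ne (l := l) hi.1)
  · simp
  · rw [← (Finset.mem_filter.1 hi).2, Fin.insertNth_self_removeNth]
  · simp

lemma inv_mul_h1 (Q : Fin n → Measure 𝒳) (a : (Fin (d + 1) → Fin n) → ℝ)
    (h : (Fin (d + 1) → 𝒳) → ℝ) (t : Fin n) (x : 𝒳) :
    (n : ℝ)⁻¹ * h1 Q a h t x = tupleRatio n (d + 1) * ∑ i ∈ distinctTuples n (d + 1),
      ∑ l, if i l = t then a i * (condKernel Q h l (l.removeNth i) x - theta Q h i) else 0 := by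
  have hratio : (n : ℝ)⁻¹ * (((n - (d + 1))! : ℝ) / ((n - 1)! : ℝ)) = tupleRatio n (d + 1) := by
    rw [tupleRatio, ← Nat.mul_factorial_pred t.pos.ne', Nat.cast_mul, inv_mul_eq_div, div_div,
      mul_comm (n : ℝ)]
  rw [h1, ← mul_assoc, hratio, Finset.sum_comm, Finset.sum_comm (s := distinctTuples n (d + 1))]
  congr 1
  exact Finset.sum_congr rfl fun l _ =>
    sum_distinctTuplesAvoiding l t fun i r => a i * (condKernel Q h l r x - theta Q h i)

lemma inv_mul_sum_h1 (Q : Fin n → Measure 𝒳) (a : (Fin (d + 1) → Fin n) → ℝ)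
    (h : (Fin (d + 1) → 𝒳) → ℝ) (x : Fin n → 𝒳) :
    (n : ℝ)⁻¹ * ∑ t, h1 Q a h t (x t) = tupleRatio n (d + 1) * ∑ i ∈ distinctTuples n (d + 1),
      a i * ∑ l, (condKernel Q h l (l.removeNth i) (x (i l)) - theta Q h i) := by
  simp only [Finset.mul_sum, inv_mul_h1]
  rw [Finset.sum_comm]
  refine Finset.sum_congr rfl fun i _ => ?_
  rw [Finset.sum_comm]
  exact Finset.sum_congr rfl fun l _ => by simp [mul_ite, Finset.sum_ite_eq]

end FirstOrderExpansion

section Variance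

variable {Ω 𝒳 : Type*} [MeasurableSpace Ω] [MeasurableSpace 𝒳] {n d : ℕ}
  {P : Measure Ω} {X : Fin n → Ω → 𝒳}
  {h : (Fin (d + 1) → 𝒳) → ℝ} {i j : Fin (d + 1) → Fin n}

lemma covariance_kernelAt_eq_zero (hX : ∀ t, Measurable (X t)) (hind : iIndepFun X P)
    (hh : Measurable h) (hij : ∀ p q, i p ≠ j q) (hHi : MemLp (kernelAt X h i) 2 P)
    (hHj : MemLp (kernelAt X h j) 2 P) : cov[kernelAt X h i, kernelAt X h j; P] = 0 :=
  ((indepFun_subtuple hX hind hij).comp hh hh).covariance_eq_zero hHi hHj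

variable [IsProbabilityMeasure P]

lemma variance_const_mul_sum_mul {ι : Type*} (s : Finset ι) (c : ℝ) (a : ι → ℝ) {Y : ι → Ω → ℝ}
    (hY : ∀ b ∈ s, MemLp (Y b) 2 P) :
    Var[fun ω => c * ∑ b ∈ s, a b * Y b ω; P]
      = c ^ 2 * ∑ b ∈ s, ∑ b' ∈ s, a b * a b' * cov[Y b, Y b'; P] := by
  have hmul : ∀ b ∈ s, MemLp (fun ω => a b * Y b ω) 2 P := fun b hb => (hY b hb).const_mul _
  rw [variance_const_mul,
    ← covariance_self (memLp_finsetSum s hmul).aestronglyMeasurable.aemeasurable,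
    covariance_fun_sum_fun_sum' hmul hmul]
  simp only [covariance_const_mul_left, covariance_const_mul_right, mul_assoc, mul_left_comm]

lemma covariance_projAt_eq_zero (hX : ∀ t, Measurable (X t)) (hind : iIndepFun X P)
    (hh : Measurable h) {p q : Fin (d + 1)} (hpq : i p ≠ j q) (hFi : MemLp (projAt P X h p i) 2 P)
    (hFj : MemLp (projAt P X h q j) 2 P) : cov[projAt P X h p i, projAt P X h q j; P] = 0 := by
  have := fun t => isProbabilityMeasure_laws (P := P) hX t
  exact ((hind.indepFun hpq).comp (measurable_condKernel _ hh p _)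
    (measurable_condKernel _ hh q _)).covariance_eq_zero hFi hFj

lemma MeetAt.covariance_kernelAt {B : ℝ} {p q : Fin (d + 1)} (hij : MeetAt i j p q)
    (hX : ∀ t, Measurable (X t)) (hind : iIndepFun X P) (hh : Measurable h)
    (hi : Function.Injective i) (hj : Function.Injective j)
    (hHi : HasSecondMomentLE (kernelAt X h i) B P)
    (hHj : HasSecondMomentLE (kernelAt X h j) B P) :
    cov[kernelAt X h i, kernelAt X h j; P] = cov[projAt P X h p i, projAt P X h q j; P] := by
  have hFi := hHi.projAt hX hind hh hi p
  have hFj := hHj.projAt hX hind hh hj q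
  have hmean : ∀ {r : Fin (d + 1) → Fin n} (l : Fin (d + 1)), Function.Injective r →
      HasSecondMomentLE (kernelAt X h r) B P →
      ∫ ω, kernelAt X h r ω ∂P = ∫ ω, projAt P X h l r ω ∂P := fun l hr hHr =>
    integral_kernelAt_eq_integral_projAt hX hind hh hr l (hHr.1.integrable one_le_two)
  rw [covariance_eq_sub hHi.1 hHj.1, covariance_eq_sub hFi.1 hFj.1, hmean p hi hHi, hmean q hj hHj]
  simp only [Pi.mul_apply]
  rw [hij.integral_kernelAt_mul_kernelAt hX hind hh hi hHi.1 hHj.1,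
    hij.integral_projAt_mul_kernelAt hX hind hh hj hFi.1 hHj.1]

lemma mainVar_eq (hX : ∀ t, Measurable (X t)) (hind : iIndepFun X P) (hh : Measurable h)
    (a : (Fin (d + 1) → Fin n) → ℝ)
    (hF : ∀ i : Fin (d + 1) → Fin n, Function.Injective i → ∀ l, MemLp (projAt P X h l i) 2 P) :
    mainVar P X a h
      = tupleRatio n (d + 1) ^ 2 * ∑ i ∈ distinctTuples n (d + 1), ∑ j ∈ distinctTuples n (d + 1),
        a i * a j * matchingSum i j fun p q => cov[projAt P X h p i, projAt P X h q j; P] := by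
  have hcentred : ∀ i ∈ distinctTuples n (d + 1), ∀ l,
      MemLp (fun ω => projAt P X h l i ω - theta (laws P X) h i) 2 P := fun i hi l =>
    (hF i (mem_distinctTuples.1 hi) l).sub (memLp_const _)
  have hexpand := variance_const_mul_sum_mul (P := P) (distinctTuples n (d + 1))
    (tupleRatio n (d + 1)) a (Y := fun i ω => ∑ l, (projAt P X h l i ω - theta (laws P X) h i))
    fun i hi => memLp_finsetSum _ fun l _ => hcentred i hi l
  simp only [mainVar, inv_mul_sum_h1]
  refine hexpand.trans ?_
  congr 1
  refine Finset.sum_congr rfl fun i hi => Finset.sum_congr rfl fun j hj => ?_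
  congr 1
  rw [covariance_fun_sum_fun_sum (hcentred i hi) (hcentred j hj), matchingSum]
  refine Finset.sum_congr rfl fun p _ => Finset.sum_congr rfl fun q _ => ?_
  have hFi := hF i (mem_distinctTuples.1 hi) p
  have hFj := hF j (mem_distinctTuples.1 hj) q
  rw [covariance_sub_const_left (hFi.integrable one_le_two),
    covariance_sub_const_right (hFj.integrable one_le_two)]
  split_ifs with hpq
  · rfl
  · exact covariance_projAt_eq_zero hX hind hh hpq hFi hFj

theorem abs_variance_uStat_sub_mainVar_le (hX : ∀ t, Measurable (X t)) (hind : iIndepFun X P)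
    (hh : Measurable h) (a : (Fin (d + 1) → Fin n) → ℝ) {B : ℝ}
    (hB : ∀ i : Fin (d + 1) → Fin n, Function.Injective i →
      HasSecondMomentLE (kernelAt X h i) B P) :
    |Var[fun ω => uStat a h (fun t => X t ω); P] - mainVar P X a h|
      ≤ (1 + (d + 1) ^ 2) * B * sharedWeight a 2 := by
  have hF := fun i hi l => (hB i hi).projAt hX hind hh hi l
  have hU : Var[fun ω => uStat a h (fun t => X t ω); P]
      = tupleRatio n (d + 1) ^ 2 * ∑ i ∈ distinctTuples n (d + 1), ∑ j ∈ distinctTuples n (d + 1),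
        a i * a j * cov[kernelAt X h i, kernelAt X h j; P] :=
    variance_const_mul_sum_mul _ _ _ fun i hi => (hB i (mem_distinctTuples.1 hi)).1
  rw [hU, mainVar_eq hX hind hh a fun i hi l => (hF i hi l).1, ← mul_sub]
  simp only [← Finset.sum_sub_distrib, ← mul_sub]
  refine (abs_sum_sum_mul_le (B₁ := 0) (B₂ := (1 + (d + 1) ^ 2) * B) a le_rfl ?_ ?_ ?_).trans_eq
    (by rw [zero_mul, zero_add])
  · intro i j hij hi hj
    rw [covariance_kernelAt_eq_zero hX hind hh hij (hB i hi).1 (hB j hj).1,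
      matchingSum_eq_zero hij, sub_zero]
  · intro i j p q hij hi hj
    rw [hij.matchingSum_eq, hij.covariance_kernelAt hX hind hh hi hj (hB i hi) (hB j hj), sub_self,
      abs_zero]
  · intro i j hi hj
    have hproj := abs_matchingSum_le (i := i) (j := j) fun p q =>
      (hF i hi p).abs_covariance_le (hF j hj q)
    simp only [Fintype.card_fin, Nat.cast_add, Nat.cast_one] at hproj
    refine (abs_sub _ _).trans ?_
    linarith [(hB i hi).abs_covariance_le (hB j hj)]

end Variance

section Empirical

variable {𝒳 : Type*} [MeasurableSpace 𝒳] {n : ℕ}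

lemma integral_eq_expect {ι : Type*} [Fintype ι] [MeasurableSpace ι] [MeasurableSingletonClass ι]
    {μ : Measure ι} [IsFiniteMeasure μ] (hμ : ∀ i, μ.real {i} = (Fintype.card ι : ℝ)⁻¹)
    (g : ι → ℝ) : ∫ i, g i ∂μ = 𝔼 i, g i := by
  rw [integral_fintype .of_finite, Fintype.expect_eq_sum_div_card, div_eq_inv_mul, Finset.mul_sum]
  simp only [hμ, smul_eq_mul]

instance isProbabilityMeasure_empirical [NeZero n] (x : Fin n → 𝒳) :
    IsProbabilityMeasure (empirical x) := by
  constructor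
  simp only [empirical, Measure.smul_apply, Measure.coe_finsetSum, Finset.sum_apply,
    measure_univ, Finset.sum_const, Finset.card_univ, Fintype.card_fin, nsmul_eq_mul, mul_one,
    smul_eq_mul]
  exact ENNReal.inv_mul_cancel (by exact_mod_cast NeZero.ne n) (ENNReal.natCast_ne_top n)

instance isProbabilityMeasure_bootstrapLaw [NeZero n] (x : Fin n → 𝒳) :
    IsProbabilityMeasure (bootstrapLaw x) := by
  unfold bootstrapLaw
  infer_instance

lemma empirical_eq_map (x : Fin n → 𝒳) :
    empirical x = (empirical (id : Fin n → Fin n)).map x := by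
  have hx : Measurable x := measurable_of_finite x
  ext s hs
  rw [Measure.map_apply hx hs]
  simp only [empirical, Measure.smul_apply, Measure.coe_finsetSum, Finset.sum_apply, smul_eq_mul,
    Measure.dirac_apply' _ hs, Measure.dirac_apply' _ (hx hs), id]
  rfl

lemma empirical_id_singleton (j : Fin n) :
    empirical (id : Fin n → Fin n) {j} = (n : ℝ≥0∞)⁻¹ := by
  simp [empirical, Set.indicator_apply]

variable [NeZero n] {κ : Type*} [Fintype κ] (x : Fin n → 𝒳)

lemma pi_empirical_eq_map :
    (Measure.pi fun _ : κ => empirical x)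
      = (Measure.pi fun _ : κ => empirical (id : Fin n → Fin n)).map fun r k => x (r k) := by
  have : IsProbabilityMeasure ((empirical (id : Fin n → Fin n)).map x) :=
    Measure.isProbabilityMeasure_map (measurable_of_finite x).aemeasurable
  rw [empirical_eq_map x]
  exact (Measure.pi_map_pi fun _ => (measurable_of_finite x).aemeasurable).symm

lemma integral_empirical {g : 𝒳 → ℝ} (hg : Measurable g) :
    ∫ y, g y ∂(empirical x) = 𝔼 j, g (x j) := by
  rw [empirical_eq_map, integral_map (measurable_of_finite _).aemeasurable hg.aestronglyMeasurable]
  exact integral_eq_expect (fun j => by simp [measureReal_def, empirical_id_singleton]) _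

lemma integral_pi_empirical [DecidableEq κ] {g : (κ → 𝒳) → ℝ} (hg : Measurable g) :
    ∫ y, g y ∂(Measure.pi fun _ : κ => empirical x) = 𝔼 r : κ → Fin n, g fun k => x (r k) := by
  rw [pi_empirical_eq_map, integral_map (measurable_of_finite _).aemeasurable
    hg.aestronglyMeasurable]
  exact integral_eq_expect
    (fun r => by simp [measureReal_def, Measure.pi_singleton, empirical_id_singleton]) _

lemma memLp_empirical {g : 𝒳 → ℝ} (hg : Measurable g) (p : ℝ≥0∞) : MemLp g p (empirical x) := by
  rw [empirical_eq_map]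
  exact (memLp_map_measure_iff hg.aestronglyMeasurable (measurable_of_finite _).aemeasurable).2
    .of_discrete

lemma memLp_pi_empirical {g : (κ → 𝒳) → ℝ} (hg : Measurable g) (p : ℝ≥0∞) :
    MemLp g p (Measure.pi fun _ : κ => empirical x) := by
  rw [pi_empirical_eq_map]
  exact (memLp_map_measure_iff hg.aestronglyMeasurable (measurable_of_finite _).aemeasurable).2
    .of_discrete

lemma variance_empirical {g : 𝒳 → ℝ} (hg : Measurable g) :
    Var[g; empirical x] = 𝔼 j, g (x j) ^ 2 - (𝔼 j, g (x j)) ^ 2 := by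
  rw [variance_eq_sub (memLp_empirical x hg 2), integral_empirical x hg]
  congr 1
  exact integral_empirical x (hg.pow_const 2)

lemma variance_sum_bootstrapLaw {g : Fin n → 𝒳 → ℝ} (hg : ∀ t, Measurable (g t)) :
    Var[fun y => ∑ t, g t (y t); bootstrapLaw x] = ∑ t, Var[g t; empirical x] := by
  have hsum := variance_sum_pi (μ := fun _ : Fin n => empirical x)
    fun t => memLp_empirical x (hg t) 2
  rw [Finset.sum_fn] at hsum
  exact hsum

end Empirical

section Bootstrap

variable {𝒳 : Type*} [MeasurableSpace 𝒳] {n d : ℕ}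

/-- The average of the squared kernel over all index tuples, repetitions included. -/
def meanSqKernel {m : ℕ} (h : (Fin m → 𝒳) → ℝ) (x : Fin n → 𝒳) : ℝ :=
  𝔼 r : Fin m → Fin n, h (fun k => x (r k)) ^ 2

/-- The conditional variance, at the bootstrap sample drawn from `x`, of the first order expansion
formed with the laws `Q`. -/
def bootProjVar (Q : Fin n → Measure 𝒳) (a : (Fin (d + 1) → Fin n) → ℝ)
    (h : (Fin (d + 1) → 𝒳) → ℝ) (x : Fin n → 𝒳) : ℝ :=
  Var[fun y => ∑ t, (n : ℝ)⁻¹ * h1 Q a h t (y t); bootstrapLaw x]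

/-- The conditional variance, at the bootstrap sample drawn from `x`, of the change in the first
order expansion when the empirical distribution replaces the laws `Q`. -/
def bootProjGap (Q : Fin n → Measure 𝒳) (a : (Fin (d + 1) → Fin n) → ℝ)
    (h : (Fin (d + 1) → 𝒳) → ℝ) (x : Fin n → 𝒳) : ℝ :=
  Var[fun y => ∑ t, (n : ℝ)⁻¹ * (h1 (fun _ => empirical x) a h t (y t) - h1 Q a h t (y t));
    bootstrapLaw x]

lemma measurable_h1 (Q : Fin n → Measure 𝒳) [∀ t, IsProbabilityMeasure (Q t)]
    (a : (Fin (d + 1) → Fin n) → ℝ) {h : (Fin (d + 1) → 𝒳) → ℝ} (hh : Measurable h) (t : Fin n) :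
    Measurable (h1 Q a h t) :=
  (Finset.measurable_fun_sum _ fun _ _ => Finset.measurable_fun_sum _ fun _ _ =>
    ((measurable_condKernel Q hh _ _).sub_const _).const_mul _).const_mul _

variable [NeZero n] {h : (Fin (d + 1) → 𝒳) → ℝ}

lemma laws_bootstrapLaw (x : Fin n → 𝒳) :
    laws (bootstrapLaw x) (fun t (y : Fin n → 𝒳) => y t) = fun _ => empirical x :=
  funext fun t => (measurePreserving_eval (fun _ : Fin n => empirical x) t).map_eq

lemma bootProjVar_eq (Q : Fin n → Measure 𝒳) [∀ t, IsProbabilityMeasure (Q t)]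
    (a : (Fin (d + 1) → Fin n) → ℝ) (hh : Measurable h) (x : Fin n → 𝒳) :
    bootProjVar Q a h x = ∑ t, (n : ℝ)⁻¹ ^ 2 * Var[h1 Q a h t; empirical x] := by
  rw [bootProjVar, variance_sum_bootstrapLaw x fun t => (measurable_h1 Q a hh t).const_mul _]
  simp only [variance_const_mul]

lemma abs_variance_uStat_sub_bootProjVar_empirical_le (a : (Fin (d + 1) → Fin n) → ℝ)
    (hh : Measurable h) (x : Fin n → 𝒳) :
    |Var[uStat a h; bootstrapLaw x] - bootProjVar (fun _ => empirical x) a h x|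
      ≤ (1 + (d + 1) ^ 2) * meanSqKernel h x * sharedWeight a 2 := by
  have hcoord : ∀ t : Fin n, Measurable fun y : Fin n → 𝒳 => y t := measurable_pi_apply
  have hind : iIndepFun (fun t (y : Fin n → 𝒳) => y t) (bootstrapLaw x) :=
    iIndepFun_pi (X := fun _ z => z) fun _ => aemeasurable_id
  have hmain : bootProjVar (fun _ => empirical x) a h x
      = mainVar (bootstrapLaw x) (fun t (y : Fin n → 𝒳) => y t) a h := by
    simp only [bootProjVar, mainVar, laws_bootstrapLaw, Finset.mul_sum]
  rw [hmain]
  refine abs_variance_uStat_sub_mainVar_le hcoord hind hh a fun i hi => ?_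
  refine (HasSecondMomentLE.comp_iff (measurable_pi_lambda _ fun k => hcoord (i k)).aemeasurable
    hh.aestronglyMeasurable).2 ?_
  rw [map_subtuple hcoord hind hi, laws_bootstrapLaw]
  exact ⟨memLp_pi_empirical x hh 2, (integral_pi_empirical x (hh.pow_const 2)).le⟩

theorem abs_variance_uStat_bootstrapLaw_sub_bootProjVar_le (Q : Fin n → Measure 𝒳)
    [∀ t, IsProbabilityMeasure (Q t)] (a : (Fin (d + 1) → Fin n) → ℝ) (hh : Measurable h)
    (x : Fin n → 𝒳) :
    |Var[uStat a h; bootstrapLaw x] - bootProjVar Q a h x|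
      ≤ (1 + (d + 1) ^ 2) * meanSqKernel h x * sharedWeight a 2
        + (bootProjGap Q a h x + 2 * √(bootProjGap Q a h x * bootProjVar Q a h x)) := by
  have hmemLp : ∀ (Q' : Fin n → Measure 𝒳) [∀ t, IsProbabilityMeasure (Q' t)],
      MemLp (fun y => ∑ t, (n : ℝ)⁻¹ * h1 Q' a h t (y t)) 2 (bootstrapLaw x) := fun Q' _ =>
    memLp_pi_empirical x (Finset.measurable_fun_sum _ fun t _ =>
      ((measurable_h1 Q' a hh t).comp (measurable_pi_apply t)).const_mul _) 2
  have hswap := abs_variance_sub_variance_le (hmemLp fun _ => empirical x) (hmemLp Q)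
  simp only [← Finset.sum_sub_distrib, ← mul_sub] at hswap
  exact (abs_sub_le _ (bootProjVar (fun _ => empirical x) a h x) _).trans
    (add_le_add (abs_variance_uStat_sub_bootProjVar_empirical_le a hh x) hswap)

end Bootstrap

section ProjectionGap

variable {𝒳 : Type*} [MeasurableSpace 𝒳] {n d : ℕ}

/-- The change in the projection of the kernel on position `l` when the empirical distribution of
`x` replaces the laws `Q`. -/
def projChange (Q : Fin n → Measure 𝒳) (h : (Fin (d + 1) → 𝒳) → ℝ) (x : Fin n → 𝒳)
    (l : Fin (d + 1)) (r : Fin d → Fin n) (y : 𝒳) : ℝ :=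
  condKernel (fun _ => empirical x) h l r y - condKernel Q h l r y

/-- The mean square of the change in the first order expansion when the empirical distribution of
`x` replaces the laws `Q`, before centering: the means `θ` are left out. -/
def projGap (Q : Fin n → Measure 𝒳) (a : (Fin (d + 1) → Fin n) → ℝ) (h : (Fin (d + 1) → 𝒳) → ℝ)
    (x : Fin n → 𝒳) : ℝ :=
  ∑ t, 𝔼 τ, (tupleRatio n (d + 1) * ∑ i ∈ distinctTuples n (d + 1), ∑ l,
    if i l = t then a i * projChange Q h x l (l.removeNth i) (x τ) else 0) ^ 2

lemma projGap_nonneg (Q : Fin n → Measure 𝒳) (a : (Fin (d + 1) → Fin n) → ℝ)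
    (h : (Fin (d + 1) → 𝒳) → ℝ) (x : Fin n → 𝒳) : 0 ≤ projGap Q a h x :=
  Finset.sum_nonneg fun _ _ => Finset.expect_nonneg fun _ _ => sq_nonneg _

lemma sum_sq_sum_ite_eq {m : ℕ} (I : Finset (Fin m → Fin n)) (a : (Fin m → Fin n) → ℝ)
    (D : (Fin m → Fin n) → Fin m → ℝ) :
    ∑ t, (∑ i ∈ I, ∑ l, if i l = t then a i * D i l else 0) ^ 2
      = ∑ i ∈ I, ∑ j ∈ I, a i * a j * matchingSum i j fun p q => D i p * D j q := by
  simp only [sq, Finset.sum_mul_sum]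
  rw [Finset.sum_comm]
  refine Finset.sum_congr rfl fun i _ => ?_
  rw [Finset.sum_comm]
  refine Finset.sum_congr rfl fun j _ => ?_
  rw [Finset.sum_comm, matchingSum, Finset.mul_sum]
  refine Finset.sum_congr rfl fun p _ => ?_
  rw [Finset.sum_comm, Finset.mul_sum]
  refine Finset.sum_congr rfl fun q _ => ?_
  simp only [ite_mul, mul_ite, zero_mul, mul_zero, mul_mul_mul_comm, Finset.sum_ite_eq,
    Finset.mem_univ, if_true, eq_comm (a := i p)]

lemma expect_matchingSum {ι κ α β : Type*} [Fintype ι] [Fintype κ] [Fintype β] [DecidableEq α]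
    (i : ι → α) (j : κ → α) (c : β → ι → κ → ℝ) :
    𝔼 b, matchingSum i j (c b) = matchingSum i j fun p q => 𝔼 b, c b p q := by
  simp only [matchingSum, Finset.expect_sum_comm]
  refine Finset.sum_congr rfl fun p _ => Finset.sum_congr rfl fun q _ => ?_
  split_ifs
  · rfl
  · exact Finset.expect_const_zero _

lemma projGap_eq (Q : Fin n → Measure 𝒳) (a : (Fin (d + 1) → Fin n) → ℝ)
    (h : (Fin (d + 1) → 𝒳) → ℝ) (x : Fin n → 𝒳) :
    projGap Q a h x = tupleRatio n (d + 1) ^ 2 *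
      ∑ i ∈ distinctTuples n (d + 1), ∑ j ∈ distinctTuples n (d + 1), a i * a j *
        matchingSum i j fun p q => 𝔼 τ, projChange Q h x p (p.removeNth i) (x τ)
          * projChange Q h x q (q.removeNth j) (x τ) := by
  rw [projGap, ← Finset.expect_sum_comm]
  simp only [mul_pow, ← Finset.mul_sum, sum_sq_sum_ite_eq _ a
    fun i l => projChange Q h x l (l.removeNth i) (x _), ← Finset.mul_expect,
    Finset.expect_sum_comm, expect_matchingSum]

lemma inv_mul_h1_empirical_sub_h1 (Q : Fin n → Measure 𝒳) (a : (Fin (d + 1) → Fin n) → ℝ)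
    (h : (Fin (d + 1) → 𝒳) → ℝ) (x : Fin n → 𝒳) (t : Fin n) (y : 𝒳) :
    (n : ℝ)⁻¹ * (h1 (fun _ => empirical x) a h t y - h1 Q a h t y)
      = tupleRatio n (d + 1) * (∑ i ∈ distinctTuples n (d + 1), ∑ l,
          if i l = t then a i * projChange Q h x l (l.removeNth i) y else 0)
        - tupleRatio n (d + 1) * ∑ i ∈ distinctTuples n (d + 1), ∑ l,
          if i l = t then a i * (theta (fun _ => empirical x) h i - theta Q h i) else 0 := by
  rw [mul_sub, inv_mul_h1, inv_mul_h1, ← mul_sub, ← mul_sub]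
  simp only [← Finset.sum_sub_distrib]
  congr 1
  refine Finset.sum_congr rfl fun i _ => Finset.sum_congr rfl fun l _ => ?_
  rw [projChange]
  split_ifs <;> ring

lemma bootProjGap_le_projGap [NeZero n] (Q : Fin n → Measure 𝒳)
    [∀ t, IsProbabilityMeasure (Q t)] (a : (Fin (d + 1) → Fin n) → ℝ)
    {h : (Fin (d + 1) → 𝒳) → ℝ} (hh : Measurable h) (x : Fin n → 𝒳) :
    bootProjGap Q a h x ≤ projGap Q a h x := by
  have hchange : ∀ t, Measurable fun y => tupleRatio n (d + 1) * ∑ i ∈ distinctTuples n (d + 1),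
      ∑ l, if i l = t then a i * projChange Q h x l (l.removeNth i) y else 0 := fun t =>
    (Finset.measurable_fun_sum _ fun i _ => Finset.measurable_fun_sum _ fun l _ => by
      split_ifs
      exacts [((measurable_condKernel _ hh _ _).sub (measurable_condKernel Q hh _ _)).const_mul _,
        measurable_const]).const_mul _
  rw [bootProjGap, variance_sum_bootstrapLaw (g := fun t y => (n : ℝ)⁻¹
    * (h1 (fun _ => empirical x) a h t y - h1 Q a h t y)) x fun t =>
    ((measurable_h1 _ a hh t).sub (measurable_h1 Q a hh t)).const_mul _]
  refine Finset.sum_le_sum fun t _ => ?_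
  simp only [inv_mul_h1_empirical_sub_h1]
  rw [variance_sub_const (hchange t).aestronglyMeasurable, variance_empirical x (hchange t)]
  exact sub_le_self _ (sq_nonneg _)

end ProjectionGap

section CrossMoments

lemma integral_sub_mul_sub {α : Type*} [MeasurableSpace α] {μ : Measure α} {f f' g g' : α → ℝ}
    (hf : MemLp f 2 μ) (hf' : MemLp f' 2 μ) (hg : MemLp g 2 μ) (hg' : MemLp g' 2 μ) :
    ∫ x, (f x - f' x) * (g x - g' x) ∂μ
      = (∫ x, f x * g x ∂μ - ∫ x, f' x * g x ∂μ)
        - (∫ x, f x * g' x ∂μ - ∫ x, f' x * g' x ∂μ) := by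
  have hfg : Integrable (fun x => f x * g x) μ := hf.integrable_mul hg
  have hfg' : Integrable (fun x => f x * g' x) μ := hf.integrable_mul hg'
  have hf'g : Integrable (fun x => f' x * g x) μ := hf'.integrable_mul hg
  have hf'g' : Integrable (fun x => f' x * g' x) μ := hf'.integrable_mul hg'
  have hleft : Integrable (fun x => f x * g x - f' x * g x) μ := hfg.sub hf'g
  have hright : Integrable (fun x => f x * g' x - f' x * g' x) μ := hfg'.sub hf'g'
  rw [← integral_sub hfg hf'g, ← integral_sub hfg' hf'g', ← integral_sub hleft hright]
  exact integral_congr_ae (ae_of_all _ fun x => by ring)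

variable {Ω 𝒳 : Type*} [MeasurableSpace Ω] [MeasurableSpace 𝒳] {n d : ℕ}
  {P : Measure Ω} {X : Fin n → Ω → 𝒳}

lemma crossGap_nonneg {m : ℕ} (h : (Fin m → 𝒳) → ℝ) : 0 ≤ crossGap P X h := by
  refine Real.sSup_nonneg ?_
  rintro v ⟨p, q, r, -, s, -, k, -, -, -, -, -, rfl⟩
  exact abs_nonneg _

variable [IsProbabilityMeasure P]

lemma crossMoment_eq (hX : ∀ t, Measurable (X t)) {m : ℕ} (h : (Fin m → 𝒳) → ℝ)
    (r s : Fin m → Fin n) (c : Fin n) :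
    crossMoment P X h r s c = ∫ ω, kernelAt X h r ω * kernelAt X h s ω ∂P :=
  integral_condExp (hX c).comap_le

lemma MeetAt.abs_integral_kernelAt_mul_sub_le {m : ℕ} {r s k : Fin m → Fin n} {p q : Fin m}
    (hrs : MeetAt r s p q) (hks : MeetAt k s p q) (hX : ∀ t, Measurable (X t))
    (h : (Fin m → 𝒳) → ℝ) (hr : Function.Injective r) (hs : Function.Injective s)
    (hk : Function.Injective k) :
    |∫ ω, kernelAt X h r ω * kernelAt X h s ω ∂P - ∫ ω, kernelAt X h k ω * kernelAt X h s ω ∂P|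
      ≤ crossGap P X h := by
  rw [← crossMoment_eq hX h r s (k p), ← crossMoment_eq hX h k s (k p)]
  refine le_csSup (Set.Finite.bddAbove ?_) ⟨p, q, r, mem_distinctTuples.2 hr, s,
    mem_distinctTuples.2 hs, k, mem_distinctTuples.2 hk, hrs.range_inter_range, hrs.apply_eq,
    hks.range_inter_range, hks.apply_eq, rfl⟩
  refine (Set.finite_range fun z : Fin m × (Fin m → Fin n) × (Fin m → Fin n) × (Fin m → Fin n) =>
    |crossMoment P X h z.2.1 z.2.2.1 (z.2.2.2 z.1)
      - crossMoment P X h z.2.2.2 z.2.2.1 (z.2.2.2 z.1)|).subset ?_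
  rintro v ⟨p, q, r, -, s, -, k, -, -, -, -, -, rfl⟩
  exact ⟨(p, r, s, k), rfl⟩

/-- The kernel at the tuple `w`, minus its projection at the tuple `u` on the variable in position
`l`. It is used for tuples with `w l = u l`, and is then a term of the difference of the projections
under the empirical distribution and under the true laws. -/
def kernelDev (P : Measure Ω) (X : Fin n → Ω → 𝒳) (h : (Fin (d + 1) → 𝒳) → ℝ) (l : Fin (d + 1))
    (u w : Fin (d + 1) → Fin n) (ω : Ω) : ℝ :=
  kernelAt X h w ω - projAt P X h l u ω

variable {h : (Fin (d + 1) → 𝒳) → ℝ} {u u' w w' : Fin (d + 1) → Fin n}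

/-- Integrating out the unshared variables turns each projection back into the kernel at the same
tuple, so that the four terms of the product pair off into two differences of cross moments. -/
lemma abs_integral_kernelDev_mul_le (hX : ∀ t, Measurable (X t)) (hind : iIndepFun X P)
    (hh : Measurable h) {p q : Fin (d + 1)} (huu' : MeetAt u u' p q) (huw' : MeetAt u w' p q)
    (hwu' : MeetAt w u' p q) (hww' : MeetAt w w' p q)
    (hL : ∀ i : Fin (d + 1) → Fin n, Function.Injective i → MemLp (kernelAt X h i) 2 P)
    (hu : Function.Injective u) (hu' : Function.Injective u') (hw : Function.Injective w)
    (hw' : Function.Injective w') :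
    |∫ ω, kernelDev P X h p u w ω * kernelDev P X h q u' w' ω ∂P| ≤ 2 * crossGap P X h := by
  have hF : ∀ {i : Fin (d + 1) → Fin n} (l : Fin (d + 1)), Function.Injective i →
      MemLp (projAt P X h l i) 2 P := fun l hi =>
    (HasSecondMomentLE.projAt hX hind hh hi ⟨hL _ hi, le_rfl⟩ l).1
  have hFH := huw'.integral_kernelAt_mul_kernelAt hX hind hh hu (hL u hu) (hL w' hw')
  have hHF := hwu'.symm.integral_kernelAt_mul_kernelAt hX hind hh hu' (hL u' hu') (hL w hw)
  have hFF := (huu'.integral_kernelAt_mul_kernelAt hX hind hh hu (hL u hu) (hL u' hu')).trans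
    (huu'.integral_projAt_mul_kernelAt hX hind hh hu' (hF p hu) (hL u' hu'))
  have hexpand : ∫ ω, kernelDev P X h p u w ω * kernelDev P X h q u' w' ω ∂P
      = (∫ ω, kernelAt X h w ω * kernelAt X h w' ω ∂P
          - ∫ ω, kernelAt X h u ω * kernelAt X h w' ω ∂P)
        - (∫ ω, kernelAt X h w ω * kernelAt X h u' ω ∂P
          - ∫ ω, kernelAt X h u ω * kernelAt X h u' ω ∂P) := by
    simp only [mul_comm (kernelAt X h w _) (kernelAt X h u' _)]
    rw [hFH, hHF, hFF]
    simp only [kernelDev, integral_sub_mul_sub (hL w hw) (hF p hu) (hL w' hw') (hF q hu'),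
      mul_comm (kernelAt X h w _) (projAt P X h q u' _)]
  rw [hexpand]
  refine (abs_sub _ _).trans ?_
  linarith [hww'.abs_integral_kernelAt_mul_sub_le (P := P) huw' hX h hw hw' hu,
    hwu'.abs_integral_kernelAt_mul_sub_le (P := P) huu' hX h hw hu' hu]

end CrossMoments

section ExpectedGap

lemma integrable_expect {α β : Type*} [MeasurableSpace α] [Fintype β] {μ : Measure α}
    {f : β → α → ℝ} (hf : ∀ b, Integrable (f b) μ) : Integrable (fun x => 𝔼 b, f b x) μ := by
  simp only [Fintype.expect_eq_sum_div_card]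
  exact (integrable_finsetSum _ fun b _ => hf b).div_const _

lemma integral_expect {α β : Type*} [MeasurableSpace α] [Fintype β] {μ : Measure α}
    {f : β → α → ℝ} (hf : ∀ b, Integrable (f b) μ) :
    ∫ x, 𝔼 b, f b x ∂μ = 𝔼 b, ∫ x, f b x ∂μ := by
  simp only [Fintype.expect_eq_sum_div_card]
  rw [integral_div, integral_finsetSum _ fun b _ => hf b]

section MatchingSum

variable {α ι κ β : Type*} [MeasurableSpace α] [Fintype ι] [Fintype κ] [DecidableEq β]
  {μ : Measure α} {i : ι → β} {j : κ → β} {c : ι → κ → α → ℝ}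

lemma integrable_matchingSum (hc : ∀ p q, Integrable (c p q) μ) :
    Integrable (fun x => matchingSum i j fun p q => c p q x) μ := by
  refine integrable_finsetSum _ fun p _ => integrable_finsetSum _ fun q _ => ?_
  split_ifs
  exacts [hc p q, integrable_zero _ _ _]

lemma integral_matchingSum (hc : ∀ p q, Integrable (c p q) μ) :
    ∫ x, matchingSum i j (fun p q => c p q x) ∂μ = matchingSum i j fun p q => ∫ x, c p q x ∂μ := by
  have hterm : ∀ p q, Integrable (fun x => if i p = j q then c p q x else 0) μ := fun p q => by
    split_ifs
    exacts [hc p q, integrable_zero _ _ _]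
  simp only [matchingSum]
  rw [integral_finsetSum _ fun p _ => integrable_finsetSum _ fun q _ => hterm p q]
  refine Finset.sum_congr rfl fun p _ => ?_
  rw [integral_finsetSum _ fun q _ => hterm p q]
  refine Finset.sum_congr rfl fun q _ => ?_
  split_ifs
  · rfl
  · exact integral_zero _ _

end MatchingSum

lemma abs_expect_option_le {n d : ℕ} [NeZero n] (i j : Fin (d + 1) → Fin n)
    {F : (Option (Fin d ⊕ Fin d) → Fin n) → ℝ} {B C : ℝ} (hB : 0 ≤ B) (hall : ∀ g, |F g| ≤ C)
    (hgeneric : ∀ g, Function.Injective g → (∀ b k, g b ≠ i k) → (∀ b k, g b ≠ j k) →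
      |F g| ≤ B) :
    |𝔼 g, F g| ≤ B + 8 * (d + 1) ^ 2 * C * (n : ℝ)⁻¹ := by
  have hC : 0 ≤ C := (abs_nonneg _).trans (hall fun _ => i 0)
  set S : Finset (Fin n) := Finset.univ.image i ∪ Finset.univ.image j with hS
  have hcard : S.card ≤ (d + 1) + (d + 1) := (Finset.card_union_le _ _).trans
    (add_le_add (Finset.card_image_le.trans (by simp)) (Finset.card_image_le.trans (by simp)))
  have hcard' : (S.card : ℝ) ≤ (d + 1) + (d + 1) := by exact_mod_cast hcard
  have hoption : (Fintype.card (Option (Fin d ⊕ Fin d)) : ℝ) = d + d + 1 := by simp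
  refine (abs_expect_le_of_generic S hB hall fun g hg hgS => ?_).trans ?_
  · simp only [hS, Finset.mem_union, Finset.mem_image, Finset.mem_univ, true_and, not_or,
      not_exists] at hgS
    exact hgeneric g hg (fun b k => Ne.symm ((hgS b).1 k)) fun b k => Ne.symm ((hgS b).2 k)
  · rw [hoption, Fintype.card_fin, mul_comm _ C]
    gcongr
    nlinarith [Nat.cast_nonneg (α := ℝ) d]

section MeanSqKernel

variable {Ω 𝒳 : Type*} [MeasurableSpace Ω] {n d : ℕ} {P : Measure Ω} {X : Fin n → Ω → 𝒳}
  {h : (Fin (d + 1) → 𝒳) → ℝ}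

lemma meanSqKernel_nonneg (h : (Fin (d + 1) → 𝒳) → ℝ) (x : Fin n → 𝒳) : 0 ≤ meanSqKernel h x :=
  Finset.expect_nonneg fun _ _ => sq_nonneg _

lemma integrable_meanSqKernel {K : ℝ} (hK : ∀ i, HasSecondMomentLE (kernelAt X h i) K P) :
    Integrable (fun ω => meanSqKernel h fun t => X t ω) P :=
  integrable_expect fun i => (hK i).1.integrable_sq

lemma integral_meanSqKernel_le [NeZero n] {B K : ℝ} (hB₀ : 0 ≤ B)
    (hB : ∀ i : Fin (d + 1) → Fin n, Function.Injective i → HasSecondMomentLE (kernelAt X h i) B P)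
    (hK : ∀ i, HasSecondMomentLE (kernelAt X h i) K P) :
    ∫ ω, meanSqKernel h (fun t => X t ω) ∂P ≤ B + (d + 1) ^ 2 * K * (n : ℝ)⁻¹ := by
  have hnonneg : ∀ i, 0 ≤ ∫ ω, kernelAt X h i ω ^ 2 ∂P := fun i =>
    integral_nonneg fun ω => sq_nonneg _
  have hmean := abs_expect_le_of_generic ∅ (F := fun i => ∫ ω, kernelAt X h i ω ^ 2 ∂P) hB₀
    (fun i => (abs_of_nonneg (hnonneg i)).trans_le (hK i).2)
    fun i hi _ => (abs_of_nonneg (hnonneg i)).trans_le (hB i hi).2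
  simp only [Fintype.card_fin, Finset.card_empty, Nat.cast_zero, mul_zero, add_zero, Nat.cast_add,
    Nat.cast_one] at hmean
  calc ∫ ω, meanSqKernel h (fun t => X t ω) ∂P
      = 𝔼 i, ∫ ω, kernelAt X h i ω ^ 2 ∂P := integral_expect fun i => (hK i).1.integrable_sq
    _ ≤ B + (d + 1) ^ 2 * K * (n : ℝ)⁻¹ := by
        rw [mul_comm _ K]
        exact (le_abs_self _).trans hmean

end MeanSqKernel

variable {Ω 𝒳 : Type*} [MeasurableSpace Ω] [MeasurableSpace 𝒳] {n d : ℕ}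
  {P : Measure Ω} {X : Fin n → Ω → 𝒳} {h : (Fin (d + 1) → 𝒳) → ℝ}

lemma projChange_laws_eq_expect [NeZero n] (hh : Measurable h) (l : Fin (d + 1))
    (s : Fin d → Fin n) (τ : Fin n) (ω : Ω) :
    projChange (laws P X) h (fun t => X t ω) l s (X τ ω)
      = 𝔼 r, kernelDev P X h l (l.insertNth τ s) (l.insertNth τ r) ω := by
  simp only [kernelDev, kernelAt, projAt, Fin.insertNth_apply_same, Fin.removeNth_insertNth]
  rw [Finset.expect_sub_distrib, Fintype.expect_const, projChange]
  congr 1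
  rw [condKernel, integral_pi_empirical (g := fun y => h (l.insertNth (X τ ω) y)) _
    (hh.comp (measurable_insertNth l measurable_const measurable_id))]
  simp only [comp_insertNth fun t => X t ω]

/-- The term that one choice `g` of indices contributes to the mean product of two changed
projections: both are evaluated at the sample point with index `g none`, and the other entries of
`g` select the sample points that replace the remaining arguments. -/
def devProd (P : Measure Ω) (X : Fin n → Ω → 𝒳) (h : (Fin (d + 1) → 𝒳) → ℝ)
    (i j : Fin (d + 1) → Fin n) (p q : Fin (d + 1)) (g : Option (Fin d ⊕ Fin d) → Fin n)
    (ω : Ω) : ℝ :=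
  kernelDev P X h p (p.insertNth (g none) (p.removeNth i))
      (p.insertNth (g none) fun k => g (some (Sum.inl k))) ω
    * kernelDev P X h q (q.insertNth (g none) (q.removeNth j))
      (q.insertNth (g none) fun k => g (some (Sum.inr k))) ω

lemma expect_projChange_mul_projChange [NeZero n] (hh : Measurable h) (i j : Fin (d + 1) → Fin n)
    (p q : Fin (d + 1)) (ω : Ω) :
    𝔼 τ, projChange (laws P X) h (fun t => X t ω) p (p.removeNth i) (X τ ω)
        * projChange (laws P X) h (fun t => X t ω) q (q.removeNth j) (X τ ω)
      = 𝔼 g, devProd P X h i j p q g ω := by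
  let e : (Option (Fin d ⊕ Fin d) → Fin n) ≃ Fin n × (Fin d → Fin n) × (Fin d → Fin n) :=
    Equiv.piOptionEquivProd.trans
      (Equiv.prodCongr (Equiv.refl _) (Equiv.sumArrowEquivProdArrow _ _ _))
  simp only [projChange_laws_eq_expect hh, Fintype.expect_mul_expect]
  rw [Fintype.expect_equiv e (fun g => devProd P X h i j p q g ω) (fun z =>
    kernelDev P X h p (p.insertNth z.1 (p.removeNth i)) (p.insertNth z.1 z.2.1) ω
      * kernelDev P X h q (q.insertNth z.1 (q.removeNth j)) (q.insertNth z.1 z.2.2) ω)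
    fun _ => rfl]
  simp only [← Finset.univ_product_univ, Finset.expect_product]

/-- Second moments bounded by `K` at all index tuples. Repeated indices stand for the same variable
in the kernel itself, whereas in its projection at position `l` the index in position `l` may be
repeated and the other occurrence then stands for an independent copy. -/
structure HasVonMisesMomentLE (P : Measure Ω) (X : Fin n → Ω → 𝒳) (h : (Fin (d + 1) → 𝒳) → ℝ)
    (K : ℝ) : Prop where
  kernelAt : ∀ i, HasSecondMomentLE (kernelAt X h i) K P
  projAt : ∀ l i, Function.Injective (l.removeNth i) → HasSecondMomentLE (projAt P X h l i) K P

lemma HasVonMisesMomentLE.kernelDev {K : ℝ} (hK : HasVonMisesMomentLE P X h K)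
    {l : Fin (d + 1)} {u : Fin (d + 1) → Fin n} (hu : Function.Injective (l.removeNth u))
    (w : Fin (d + 1) → Fin n) : HasSecondMomentLE (kernelDev P X h l u w) (4 * K) P :=
  (hK.kernelAt w).sub (hK.projAt l u hu)

lemma insertNth_option_injective {β ι : Type*} {g : Option ι → β} (hg : Function.Injective g)
    {f : Fin d → ι} (hf : Function.Injective f) (l : Fin (d + 1)) :
    Function.Injective (l.insertNth (g none) fun k => g (some (f k)) : Fin (d + 1) → β) :=
  insertNth_injective (fun _ _ hk => hf (Option.some_injective _ (hg hk)))
    fun _ hk => Option.some_ne_none _ (hg hk)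

lemma insertNth_removeNth_injective {β : Type*} {i : Fin (d + 1) → β} (hi : Function.Injective i)
    {t : β} (ht : ∀ k, t ≠ i k) (l : Fin (d + 1)) :
    Function.Injective (l.insertNth t (l.removeNth i) : Fin (d + 1) → β) :=
  insertNth_injective (removeNth_injective hi) fun _ => (ht _).symm

section DevProd

variable {i j : Fin (d + 1) → Fin n} {g : Option (Fin d ⊕ Fin d) → Fin n} {B K : ℝ}

lemma hasSecondMomentLE_kernelDev_insertNth (hK : HasVonMisesMomentLE P X h K)
    (hi : Function.Injective i) (l : Fin (d + 1)) (t : Fin n) (w : Fin (d + 1) → Fin n) :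
    HasSecondMomentLE (kernelDev P X h l (l.insertNth t (l.removeNth i)) w) (4 * K) P :=
  hK.kernelDev (by simpa only [Fin.removeNth_insertNth] using removeNth_injective hi) w

lemma integrable_devProd (hK : HasVonMisesMomentLE P X h K) (hi : Function.Injective i)
    (hj : Function.Injective j) (p q : Fin (d + 1)) (g : Option (Fin d ⊕ Fin d) → Fin n) :
    Integrable (devProd P X h i j p q g) P :=
  (hasSecondMomentLE_kernelDev_insertNth hK hi p _ _).1.integrable_mul
    (hasSecondMomentLE_kernelDev_insertNth hK hj q _ _).1

lemma abs_integral_devProd_le (hK : HasVonMisesMomentLE P X h K) (hi : Function.Injective i)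
    (hj : Function.Injective j) (p q : Fin (d + 1)) (g : Option (Fin d ⊕ Fin d) → Fin n) :
    |∫ ω, devProd P X h i j p q g ω ∂P| ≤ 4 * K :=
  (hasSecondMomentLE_kernelDev_insertNth hK hi p _ _).abs_integral_mul_le
    (hasSecondMomentLE_kernelDev_insertNth hK hj q _ _)

variable [IsProbabilityMeasure P]

lemma abs_integral_devProd_le_of_generic (hX : ∀ t, Measurable (X t)) (hind : iIndepFun X P)
    (hh : Measurable h)
    (hB : ∀ i : Fin (d + 1) → Fin n, Function.Injective i → HasSecondMomentLE (kernelAt X h i) B P)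
    (hi : Function.Injective i) (hj : Function.Injective j) (hg : Function.Injective g)
    (hgi : ∀ b k, g b ≠ i k) (hgj : ∀ b k, g b ≠ j k) (p q : Fin (d + 1)) :
    |∫ ω, devProd P X h i j p q g ω ∂P| ≤ 4 * B := by
  have hdev : ∀ {u w : Fin (d + 1) → Fin n} (l : Fin (d + 1)), Function.Injective u →
      Function.Injective w → HasSecondMomentLE (kernelDev P X h l u w) (4 * B) P :=
    fun l hu hw => (hB _ hw).sub ((hB _ hu).projAt hX hind hh hu l)
  exact HasSecondMomentLE.abs_integral_mul_le
    (hdev p (insertNth_removeNth_injective hi (hgi none) p)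
      (insertNth_option_injective hg Sum.inl_injective p))
    (hdev q (insertNth_removeNth_injective hj (hgj none) q)
      (insertNth_option_injective hg Sum.inr_injective q))

lemma MeetAt.abs_integral_devProd_le {p q : Fin (d + 1)} (hij : MeetAt i j p q)
    (hX : ∀ t, Measurable (X t)) (hind : iIndepFun X P) (hh : Measurable h)
    (hL : ∀ i : Fin (d + 1) → Fin n, Function.Injective i → MemLp (kernelAt X h i) 2 P)
    (hi : Function.Injective i) (hj : Function.Injective j) (hg : Function.Injective g)
    (hgi : ∀ b k, g b ≠ i k) (hgj : ∀ b k, g b ≠ j k) :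
    |∫ ω, devProd P X h i j p q g ω ∂P| ≤ 2 * crossGap P X h := by
  have hgi' : ∀ k, p.removeNth i k ≠ g none := fun _ => (hgi _ _).symm
  have hgj' : ∀ k, q.removeNth j k ≠ g none := fun _ => (hgj _ _).symm
  have hgs : ∀ b, g (some b) ≠ g none := fun b => hg.ne (Option.some_ne_none b)
  refine abs_integral_kernelDev_mul_le hX hind hh
    (meetAt_insertNth hgi' hgj' fun k k' hk => ?_)
    (meetAt_insertNth hgi' (fun _ => hgs _) fun _ _ => (hgi _ _).symm)
    (meetAt_insertNth (fun _ => hgs _) hgj' fun _ _ => hgj _ _)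
    (meetAt_insertNth (fun _ => hgs _) (fun _ => hgs _) fun _ _ hk => ?_) hL
    (insertNth_removeNth_injective hi (hgi none) p) (insertNth_removeNth_injective hj (hgj none) q)
    (insertNth_option_injective hg Sum.inl_injective p)
    (insertNth_option_injective hg Sum.inr_injective q)
  · exact Fin.succAbove_ne p k ((hij _ _).1 hk).1
  · exact Sum.inl_ne_inr (Option.some_injective _ (hg hk))

end DevProd

lemma projGap_laws_eq [NeZero n] (a : (Fin (d + 1) → Fin n) → ℝ) (hh : Measurable h) (ω : Ω) :
    projGap (laws P X) a h (fun t => X t ω) = tupleRatio n (d + 1) ^ 2 *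
      ∑ i ∈ distinctTuples n (d + 1), ∑ j ∈ distinctTuples n (d + 1), a i * a j *
        matchingSum i j fun p q => 𝔼 g, devProd P X h i j p q g ω := by
  simp only [projGap_eq, expect_projChange_mul_projChange hh]

lemma integrable_matchingSum_expect_devProd {K : ℝ} (hK : HasVonMisesMomentLE P X h K)
    {i j : Fin (d + 1) → Fin n} (hi : i ∈ distinctTuples n (d + 1))
    (hj : j ∈ distinctTuples n (d + 1)) :
    Integrable (fun ω => matchingSum i j fun p q => 𝔼 g, devProd P X h i j p q g ω) P :=
  integrable_matchingSum fun p q => integrable_expect fun g =>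
    integrable_devProd hK (mem_distinctTuples.1 hi) (mem_distinctTuples.1 hj) p q g

lemma integrable_projGap [NeZero n] (a : (Fin (d + 1) → Fin n) → ℝ) (hh : Measurable h) {K : ℝ}
    (hK : HasVonMisesMomentLE P X h K) :
    Integrable (fun ω => projGap (laws P X) a h fun t => X t ω) P := by
  simp only [projGap_laws_eq a hh]
  exact (integrable_finsetSum _ fun i hi => integrable_finsetSum _ fun j hj =>
    (integrable_matchingSum_expect_devProd hK hi hj).const_mul _).const_mul _

lemma integral_projGap_eq [NeZero n] (a : (Fin (d + 1) → Fin n) → ℝ) (hh : Measurable h) {K : ℝ}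
    (hK : HasVonMisesMomentLE P X h K) :
    ∫ ω, projGap (laws P X) a h (fun t => X t ω) ∂P = tupleRatio n (d + 1) ^ 2 *
      ∑ i ∈ distinctTuples n (d + 1), ∑ j ∈ distinctTuples n (d + 1), a i * a j *
        matchingSum i j fun p q => 𝔼 g, ∫ ω, devProd P X h i j p q g ω ∂P := by
  have hterm : ∀ i ∈ distinctTuples n (d + 1), ∀ j ∈ distinctTuples n (d + 1),
      Integrable (fun ω => a i * a j *
        matchingSum i j fun p q => 𝔼 g, devProd P X h i j p q g ω) P := fun i hi j hj =>
    (integrable_matchingSum_expect_devProd hK hi hj).const_mul _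
  simp only [projGap_laws_eq a hh]
  rw [integral_const_mul, integral_finsetSum _ fun i hi =>
    integrable_finsetSum _ fun j hj => hterm i hi j hj]
  congr 1
  refine Finset.sum_congr rfl fun i hi => ?_
  rw [integral_finsetSum _ fun j hj => hterm i hi j hj]
  refine Finset.sum_congr rfl fun j hj => ?_
  have hdev := integrable_devProd hK (mem_distinctTuples.1 hi) (mem_distinctTuples.1 hj)
  rw [integral_const_mul, integral_matchingSum fun p q => integrable_expect (hdev p q)]
  simp only [integral_expect (hdev _ _)]

variable [IsProbabilityMeasure P]

theorem integral_projGap_le [NeZero n] (hX : ∀ t, Measurable (X t)) (hind : iIndepFun X P)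
    (hh : Measurable h) (a : (Fin (d + 1) → Fin n) → ℝ) {B K : ℝ} (hB₀ : 0 ≤ B)
    (hB : ∀ i : Fin (d + 1) → Fin n, Function.Injective i → HasSecondMomentLE (kernelAt X h i) B P)
    (hK : HasVonMisesMomentLE P X h K) :
    ∫ ω, projGap (laws P X) a h (fun t => X t ω) ∂P
      ≤ (2 * crossGap P X h + 8 * (d + 1) ^ 2 * (4 * K) * (n : ℝ)⁻¹) * sharedWeight a 1
        + (d + 1) ^ 2 * (4 * B + 8 * (d + 1) ^ 2 * (4 * K) * (n : ℝ)⁻¹) * sharedWeight a 2 := by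
  have hK₀ : 0 ≤ K := (hK.kernelAt fun _ => 0).nonneg
  have hgap := crossGap_nonneg (P := P) (X := X) h
  rw [integral_projGap_eq a hh hK]
  refine (le_abs_self _).trans (abs_sum_sum_mul_le a (by positivity) ?_ ?_ ?_)
  · exact fun i j hij _ _ => matchingSum_eq_zero hij _
  · intro i j p q hij hi hj
    rw [hij.matchingSum_eq]
    exact abs_expect_option_le i j (by positivity) (abs_integral_devProd_le hK hi hj p q)
      fun g hg hgi hgj => hij.abs_integral_devProd_le hX hind hh (fun i hi => (hB i hi).1)
        hi hj hg hgi hgj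
  · intro i j hi hj
    refine (abs_matchingSum_le fun p q => abs_expect_option_le i j (by positivity)
      (abs_integral_devProd_le hK hi hj p q) fun g hg hgi hgj =>
        abs_integral_devProd_le_of_generic hX hind hh hB hi hj hg hgi hgj p q).trans_eq ?_
    simp only [Fintype.card_fin, Nat.cast_add, Nat.cast_one, sq]

end ExpectedGap

section InProbability

variable {Ω : ℕ → Type*} [∀ n, MeasurableSpace (Ω n)] {P : ∀ n, Measure (Ω n)}

/-- The filter of the sets of pairs `⟨n, ω⟩` whose complement in `Ω n` has probability tending to
`0` as `n → ∞`. Convergence in probability is convergence along this filter, so that continuous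
mapping and squeezing are those of filter limits. -/
def highProb (P : ∀ n, Measure (Ω n)) : Filter (Σ n, Ω n) where
  sets := {S | Tendsto (fun n => P n {ω | ⟨n, ω⟩ ∉ S}) atTop (𝓝 0)}
  univ_sets := by simp
  sets_of_superset {_ _} hS hST := tendsto_of_tendsto_of_tendsto_of_le_of_le tendsto_const_nhds hS
    (fun _ => zero_le) fun _ => measure_mono fun _ hω hωS => hω (hST hωS)
  inter_sets {S T} hS hT := by
    refine tendsto_of_tendsto_of_tendsto_of_le_of_le tendsto_const_nhds
      (by simpa only [add_zero] using hS.add hT) (fun _ => zero_le) fun n => ?_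
    refine (measure_mono fun ω hω => ?_).trans (measure_union_le _ _)
    exact not_and_or.1 hω

lemma tendstoInProb_iff_tendsto {Z : ∀ n, Ω n → ℝ} {c : ℝ} :
    TendstoInProb P Z c ↔ Tendsto (fun z : Σ n, Ω n => Z z.1 z.2) (highProb P) (𝓝 c) := by
  rw [Metric.tendsto_nhds]
  refine forall₂_congr fun ε _ => ?_
  simp only [Filter.Eventually, highProb, Filter.mem_mk, Set.mem_ofPred_eq, not_lt, Real.dist_eq]

lemma tendsto_fst_highProb : Tendsto Sigma.fst (highProb P) atTop := by
  intro S hS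
  refine tendsto_const_nhds.congr' ?_
  filter_upwards [hS] with n hn
  simp [hn]

lemma tendsto_highProb_zero_of_integral_le {Z : ∀ n, Ω n → ℝ} {b : ℕ → ℝ}
    (hZ : ∀ n ω, 0 ≤ Z n ω)
    (hb : ∀ᶠ n in atTop, Integrable (Z n) (P n) ∧ ∫ ω, Z n ω ∂P n ≤ b n)
    (hlim : Tendsto b atTop (𝓝 0)) :
    Tendsto (fun z : Σ n, Ω n => Z z.1 z.2) (highProb P) (𝓝 0) := by
  refine tendstoInProb_iff_tendsto.1 fun ε hε => ?_
  have hlim' : Tendsto (fun n => ENNReal.ofReal (b n) / ENNReal.ofReal ε) atTop (𝓝 0) := by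
    have hε' : ENNReal.ofReal ε ≠ 0 := (ENNReal.ofReal_pos.2 hε).ne'
    simpa using ENNReal.Tendsto.div_const (ENNReal.tendsto_ofReal hlim) (Or.inr hε')
  refine tendsto_of_tendsto_of_tendsto_of_le_of_le' tendsto_const_nhds hlim'
    (Eventually.of_forall fun n => zero_le) ?_
  filter_upwards [hb] with n ⟨hinteg, hle⟩
  have hmarkov := meas_ge_le_lintegral_div hinteg.aemeasurable.ennreal_ofReal
    (ENNReal.ofReal_pos.2 hε).ne' ENNReal.ofReal_ne_top
  rw [← ofReal_integral_eq_lintegral_ofReal hinteg (ae_of_all _ (hZ n))] at hmarkov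
  refine (measure_mono fun ω hω => ?_).trans (hmarkov.trans (by gcongr))
  rw [Set.mem_ofPred_eq, sub_zero, abs_of_nonneg (hZ n ω)] at hω
  exact ENNReal.ofReal_le_ofReal hω

lemma exists_eventually_le_of_limsup_lt_top {f : ℕ → ℝ≥0∞} (hf : limsup f atTop < ⊤) :
    ∃ C : ℝ, ∀ᶠ n in atTop, f n ≤ ENNReal.ofReal C := by
  obtain ⟨C, hC, -⟩ := ENNReal.lt_iff_exists_nnreal_btwn.1 hf
  refine ⟨C, (eventually_lt_of_limsup_lt hC).mono fun n hn => ?_⟩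
  exact hn.le.trans_eq (ENNReal.ofReal_coe_nnreal).symm

end InProbability

section SecondMomentBounds

variable {𝒳 : Type*} [MeasurableSpace 𝒳]

lemma HasVonMisesMomentLE.of_lintegral_sq_le {Ω : Type*} [MeasurableSpace Ω] {n d : ℕ}
    {P : Measure Ω} [IsProbabilityMeasure P] {X : Fin n → Ω → 𝒳} (hX : ∀ t, Measurable (X t))
    {h : (Fin (d + 1) → 𝒳) → ℝ} (hh : Measurable h) {K : ℝ} (hK : 0 ≤ K)
    (hrepeat : ∀ i : Fin (d + 1) → Fin n,
      ∫⁻ ω, ENNReal.ofReal (h (fun l => X (i l) ω) ^ 2) ∂P ≤ ENNReal.ofReal K)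
    (hcopy : ∀ (l : Fin (d + 1)) (t : Fin n) (r : Fin d → Fin n), Function.Injective r →
      ∫⁻ x, ∫⁻ y : Fin d → 𝒳, ENNReal.ofReal (h (l.insertNth x y) ^ 2)
        ∂(Measure.pi fun k => laws P X (r k)) ∂(laws P X t) ≤ ENNReal.ofReal K) :
    HasVonMisesMomentLE P X h K where
  kernelAt i := .of_lintegral_sq_le (measurable_kernelAt hX hh i).aestronglyMeasurable hK
    (hrepeat i)
  projAt l i hi := by
    have := fun t => isProbabilityMeasure_laws (P := P) hX t
    have hmeas : Measurable fun z : 𝒳 × (Fin d → 𝒳) => h (l.insertNth z.1 z.2) :=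
      hh.comp (measurable_insertNth l measurable_fst measurable_snd)
    refine hasSecondMomentLE_projAt hX hh l (.of_lintegral_sq_le hmeas.aestronglyMeasurable hK ?_)
    rw [lintegral_prod _ (hmeas.pow_const 2).ennreal_ofReal.aemeasurable]
    exact hcopy l (i l) _ hi

lemma exists_eventually_hasVonMisesMomentLE {Ω : ℕ → Type*} [∀ n, MeasurableSpace (Ω n)]
    {P : ∀ n, Measure (Ω n)} [∀ n, IsProbabilityMeasure (P n)] {X : ∀ n, Fin n → Ω n → 𝒳}
    (hX : ∀ n i, Measurable (X n i)) {d : ℕ} {h : ℕ → (Fin (d + 1) → 𝒳) → ℝ}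
    (hh : ∀ n, Measurable (h n))
    (hvonMises : limsup (fun n => ⨆ i : Fin (d + 1) → Fin n,
      ∫⁻ ω, ENNReal.ofReal (h n (fun l => X n (i l) ω) ^ 2) ∂P n) atTop < ⊤)
    (hcopy : limsup (fun n => ⨆ (l : Fin (d + 1)) (j : Fin n) (i ∈ distinctTuples n d),
      ∫⁻ x, ∫⁻ y : Fin d → 𝒳, ENNReal.ofReal (h n (l.insertNth x y) ^ 2)
        ∂(Measure.pi fun k => laws (P n) (X n) (i k)) ∂(laws (P n) (X n) j)) atTop < ⊤) :
    ∃ K, ∀ᶠ n in atTop, HasVonMisesMomentLE (P n) (X n) (h n) K := by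
  obtain ⟨C₁, hC₁⟩ := exists_eventually_le_of_limsup_lt_top hvonMises
  obtain ⟨C₂, hC₂⟩ := exists_eventually_le_of_limsup_lt_top hcopy
  refine ⟨max 0 (max C₁ C₂), ?_⟩
  filter_upwards [hC₁, hC₂] with n hn₁ hn₂
  refine .of_lintegral_sq_le (hX n) (hh n) (le_max_left _ _) (fun i => ?_) fun l t r hr => ?_
  · refine le_trans ?_ (hn₁.trans (ENNReal.ofReal_le_ofReal (by simp)))
    exact le_iSup_of_le i le_rfl
  · refine le_trans ?_ (hn₂.trans (ENNReal.ofReal_le_ofReal (by simp)))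
    exact le_iSup_of_le l (le_iSup_of_le t (le_iSup₂_of_le r (mem_distinctTuples.2 hr) le_rfl))

end SecondMomentBounds

section Asymptotics

lemma sigma_sq {Ω 𝒳 : Type*} [MeasurableSpace Ω] {n m : ℕ} (P : Measure Ω) (X : Fin n → Ω → 𝒳)
    (a : (Fin m → Fin n) → ℝ) (h : (Fin m → 𝒳) → ℝ) :
    sigma P X a h ^ 2 = Var[fun ω => uStat a h (fun i => X i ω); P] :=
  Real.sq_sqrt (variance_nonneg _ _)

lemma variance_sigma_inv_mul_uStat {Ω 𝒳 : Type*} [MeasurableSpace Ω] {n m : ℕ} {P : Measure Ω}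
    {X : Fin n → Ω → 𝒳} {a : (Fin m → Fin n) → ℝ} {h : (Fin m → 𝒳) → ℝ}
    (hσ : sigma P X a h ^ 2 ≠ 0) :
    Var[fun ω => (sigma P X a h)⁻¹ * uStat a h (fun i => X i ω); P] = 1 := by
  rw [variance_const_mul, ← sigma_sq, inv_pow, inv_mul_cancel₀ hσ]

lemma tendsto_sharedWeight_mul {m q : ℕ} {a : ∀ n, (Fin m → Fin n) → ℝ} {u : ℕ → ℝ}
    (hu : ∀ᶠ n in atTop, 0 ≤ u n)
    (hlim : Tendsto (fun n : ℕ => ((n : ℝ) ^ q)⁻¹ * avgWeight (a n) 2 q * u n) atTop (𝓝 0)) :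
    Tendsto (fun n => sharedWeight (a n) q * u n) atTop (𝓝 0) := by
  have hlim' := hlim.const_mul (4 ^ m * (m : ℝ) ^ (2 * q))
  rw [mul_zero] at hlim'
  refine squeeze_zero' ?_ ?_ hlim'
  · filter_upwards [hu] with n hn using mul_nonneg (sharedWeight_nonneg _ _) hn
  · filter_upwards [hu, eventually_gt_atTop 0, eventually_ge_atTop (2 * m)] with n hn hpos hnm
    rw [← mul_assoc]
    exact mul_le_mul_of_nonneg_right (sharedWeight_le hpos hnm (a n) q) hn

lemma sum_sq_sub_sq_sum_eq {𝒳 : Type*} [MeasurableSpace 𝒳] {n d : ℕ} [NeZero n]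
    (Q : Fin n → Measure 𝒳)
    [∀ i, IsProbabilityMeasure (Q i)] (a : (Fin (d + 1) → Fin n) → ℝ)
    {h : (Fin (d + 1) → 𝒳) → ℝ} (hh : Measurable h) (x : Fin n → 𝒳) (s : ℝ) :
    (1 / (n : ℝ)) * ∑ i, ∑ j, (h1 Q a h i (x j) / (n * s)) ^ 2
        - (1 / (n : ℝ) ^ 2) * ∑ i, (∑ j, h1 Q a h i (x j) / (n * s)) ^ 2
      = (s ^ 2)⁻¹ * bootProjVar Q a h x := by
  rw [bootProjVar_eq Q a hh, Finset.mul_sum, Finset.mul_sum, ← Finset.sum_sub_distrib,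
    Finset.mul_sum]
  refine Finset.sum_congr rfl fun t _ => ?_
  rw [variance_empirical x (measurable_h1 Q a hh t)]
  simp only [Fintype.expect_eq_sum_div_card, Fintype.card_fin, div_eq_mul_inv, mul_inv, inv_pow,
    one_mul, mul_pow, ← Finset.sum_mul]
  ring

variable {Ω : ℕ → Type*} [∀ n, MeasurableSpace (Ω n)] {P : ∀ n, Measure (Ω n)} {𝒳 : Type*}
  {X : ∀ n, Fin n → Ω n → 𝒳} {d : ℕ} {a : ∀ n, (Fin (d + 1) → Fin n) → ℝ}
  {h : ℕ → (Fin (d + 1) → 𝒳) → ℝ} {B u : ℕ → ℝ} {K : ℝ}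

lemma eventually_nonneg_of_hasSecondMomentLE
    (hB : ∀ᶠ n in atTop, ∀ i : Fin (d + 1) → Fin n, Function.Injective i →
      HasSecondMomentLE (kernelAt (X n) (h n) i) (B n) (P n)) : ∀ᶠ n in atTop, 0 ≤ B n := by
  filter_upwards [hB, eventually_ge_atTop (d + 1)] with n hBn hn
  exact (hBn _ (Fin.castLE_injective hn)).nonneg

lemma tendsto_highProb_meanSqKernel (hu : ∀ n, 0 ≤ u n)
    (hB : ∀ᶠ n in atTop, ∀ i : Fin (d + 1) → Fin n, Function.Injective i →
      HasSecondMomentLE (kernelAt (X n) (h n) i) (B n) (P n))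
    (hK : ∀ᶠ n in atTop, ∀ i, HasSecondMomentLE (kernelAt (X n) (h n) i) K (P n))
    (hlimB : Tendsto (fun n => sharedWeight (a n) 2 * (u n * B n)) atTop (𝓝 0))
    (hlimn : Tendsto (fun n : ℕ => sharedWeight (a n) 2 * (u n * (n : ℝ)⁻¹)) atTop (𝓝 0)) :
    Tendsto (fun z : Σ n, Ω n => u z.1 *
      (meanSqKernel (h z.1) (fun t => X z.1 t z.2) * sharedWeight (a z.1) 2))
      (highProb P) (𝓝 0) := by
  have hlim := hlimB.add (hlimn.const_mul (((d : ℝ) + 1) ^ 2 * K))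
  rw [mul_zero, add_zero] at hlim
  refine tendsto_highProb_zero_of_integral_le (Z := fun n ω => u n *
    (meanSqKernel (h n) (fun t => X n t ω) * sharedWeight (a n) 2)) (fun n ω => ?_) ?_ hlim
  · exact mul_nonneg (hu n) (mul_nonneg (meanSqKernel_nonneg _ _) (sharedWeight_nonneg _ _))
  · filter_upwards [hB, hK, eventually_gt_atTop 0, eventually_nonneg_of_hasSecondMomentLE hB]
      with n hBn hKn hn hB₀
    have : NeZero n := ⟨hn.ne'⟩
    refine ⟨((integrable_meanSqKernel hKn).mul_const _).const_mul _, ?_⟩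
    rw [integral_const_mul, integral_mul_const]
    calc _ ≤ u n * ((B n + (d + 1) ^ 2 * K * (n : ℝ)⁻¹) * sharedWeight (a n) 2) :=
          mul_le_mul_of_nonneg_left (mul_le_mul_of_nonneg_right
            (integral_meanSqKernel_le hB₀ hBn hKn) (sharedWeight_nonneg _ _)) (hu n)
      _ = _ := by ring

variable [MeasurableSpace 𝒳]

lemma tendsto_sharedWeight_two_mul_inv (hu : ∀ n, 0 ≤ u n)
    (hlim : Tendsto (fun n : ℕ => sharedWeight (a n) 1 *
      (u n * (crossGap (P n) (X n) (h n) + (n : ℝ)⁻¹))) atTop (𝓝 0)) :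
    Tendsto (fun n : ℕ => sharedWeight (a n) 2 * (u n * (n : ℝ)⁻¹)) atTop (𝓝 0) := by
  have hinv : ∀ n : ℕ, 0 ≤ (n : ℝ)⁻¹ := fun n => by positivity
  refine squeeze_zero (fun n => mul_nonneg (sharedWeight_nonneg _ _) (mul_nonneg (hu n) (hinv n)))
    (fun n => ?_) hlim
  exact mul_le_mul (sharedWeight_antitone _ one_le_two)
    (mul_le_mul_of_nonneg_left (le_add_of_nonneg_left (crossGap_nonneg _)) (hu n))
    (mul_nonneg (hu n) (hinv n)) (sharedWeight_nonneg _ _)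

lemma tendsto_sharedWeight_one_mul (hu : ∀ n, 0 ≤ u n)
    (hhet : Tendsto (fun n : ℕ => (n : ℝ)⁻¹ * u n * avgWeight (a n) 2 1
      * (crossGap (P n) (X n) (h n) + (n : ℝ)⁻¹)) atTop (𝓝 0)) :
    Tendsto (fun n : ℕ => sharedWeight (a n) 1 *
      (u n * (crossGap (P n) (X n) (h n) + (n : ℝ)⁻¹))) atTop (𝓝 0) := by
  refine tendsto_sharedWeight_mul (.of_forall fun n => ?_) (hhet.congr fun n => by ring)
  exact mul_nonneg (hu n) (add_nonneg (crossGap_nonneg _) (by positivity))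

lemma tendsto_sharedWeight_two_mul_mainVar_inv
    (hB : ∀ᶠ n in atTop, ∀ i : Fin (d + 1) → Fin n, Function.Injective i →
      HasSecondMomentLE (kernelAt (X n) (h n) i) (B n) (P n))
    (hV : ∀ᶠ n in atTop, 0 < mainVar (P n) (X n) (a n) (h n))
    (hclt : Tendsto (fun n : ℕ => (n : ℝ) ^ (-2 : ℝ) * mainVar (P n) (X n) (a n) (h n) ^ (-1 : ℝ)
      * avgWeight (a n) 2 2 * B n) atTop (𝓝 0)) :
    Tendsto (fun n => sharedWeight (a n) 2 * ((mainVar (P n) (X n) (a n) (h n))⁻¹ * B n))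
      atTop (𝓝 0) := by
  refine tendsto_sharedWeight_mul ?_ (hclt.congr fun n => ?_)
  · filter_upwards [eventually_nonneg_of_hasSecondMomentLE hB, hV] with n hBn hVn
    exact mul_nonneg (inv_nonneg.2 hVn.le) hBn
  · rw [Real.rpow_neg_one, Real.rpow_neg (Nat.cast_nonneg n), Real.rpow_ofNat]
    ring

lemma tendsto_mul_crossGap_of_meanGap {w : ℕ → ℝ} (hw : ∀ n, 0 ≤ w n)
    (hlim : Tendsto (fun n : ℕ => w n *
      (meanGap (P n) (X n) (h n) ^ 2 + crossGap (P n) (X n) (h n) + (n : ℝ)⁻¹)) atTop (𝓝 0)) :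
    Tendsto (fun n : ℕ => w n * (crossGap (P n) (X n) (h n) + (n : ℝ)⁻¹)) atTop (𝓝 0) := by
  refine squeeze_zero (fun n => mul_nonneg (hw n) (add_nonneg (crossGap_nonneg _) (by positivity)))
    (fun n => mul_le_mul_of_nonneg_left ?_ (hw n)) hlim
  rw [add_assoc]
  exact le_add_of_nonneg_left (sq_nonneg _)

variable [∀ n, IsProbabilityMeasure (P n)]

lemma tendsto_sigma_sq_div_mainVar (hX : ∀ n i, Measurable (X n i))
    (hindep : ∀ n, iIndepFun (X n) (P n)) (hh : ∀ n, Measurable (h n))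
    (hB : ∀ᶠ n in atTop, ∀ i : Fin (d + 1) → Fin n, Function.Injective i →
      HasSecondMomentLE (kernelAt (X n) (h n) i) (B n) (P n))
    (hV : ∀ᶠ n in atTop, 0 < mainVar (P n) (X n) (a n) (h n))
    (hlim : Tendsto (fun n => sharedWeight (a n) 2 * ((mainVar (P n) (X n) (a n) (h n))⁻¹ * B n))
      atTop (𝓝 0)) :
    Tendsto (fun n => sigma (P n) (X n) (a n) (h n) ^ 2 / mainVar (P n) (X n) (a n) (h n))
      atTop (𝓝 1) := by
  have hlim' := hlim.const_mul (1 + ((d : ℝ) + 1) ^ 2)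
  rw [mul_zero] at hlim'
  refine tendsto_iff_dist_tendsto_zero.2 (squeeze_zero' (.of_forall fun _ => dist_nonneg) ?_ hlim')
  filter_upwards [hB, hV] with n hBn hVn
  rw [Real.dist_eq, div_sub_one hVn.ne', abs_div, abs_of_pos hVn, sigma_sq]
  calc _ ≤ (1 + ((d : ℝ) + 1) ^ 2) * B n * sharedWeight (a n) 2
        / mainVar (P n) (X n) (a n) (h n) := by
        gcongr
        exact abs_variance_uStat_sub_mainVar_le (hX n) (hindep n) (hh n) (a n) hBn
    _ = _ := by ring

lemma tendsto_highProb_bootProjVar (hX : ∀ n i, Measurable (X n i)) (hh : ∀ n, Measurable (h n))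
    {s : ℕ → ℝ} {b c : ℝ}
    (hsq : TendstoInProb P (fun n ω => (1 / (n : ℝ)) * ∑ i, ∑ j,
      (h1 (laws (P n) (X n)) (a n) (h n) i (X n j ω) / (n * s n)) ^ 2) b)
    (hsum : TendstoInProb P (fun n ω => (1 / (n : ℝ) ^ 2) * ∑ i, (∑ j,
      h1 (laws (P n) (X n)) (a n) (h n) i (X n j ω) / (n * s n)) ^ 2) c) :
    Tendsto (fun z : Σ n, Ω n => (s z.1 ^ 2)⁻¹ *
      bootProjVar (laws (P z.1) (X z.1)) (a z.1) (h z.1) fun t => X z.1 t z.2)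
      (highProb P) (𝓝 (b - c)) := by
  refine ((tendstoInProb_iff_tendsto.1 hsq).sub (tendstoInProb_iff_tendsto.1 hsum)).congr' ?_
  filter_upwards [tendsto_fst_highProb.eventually (eventually_gt_atTop 0)] with z hz
  have : NeZero z.1 := ⟨hz.ne'⟩
  have := fun t => isProbabilityMeasure_laws (P := P z.1) (hX z.1) t
  exact sum_sq_sub_sq_sum_eq _ _ (hh z.1) _ _

lemma tendsto_highProb_projGap (hX : ∀ n i, Measurable (X n i))
    (hindep : ∀ n, iIndepFun (X n) (P n)) (hh : ∀ n, Measurable (h n)) (hu : ∀ n, 0 ≤ u n)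
    (hB : ∀ᶠ n in atTop, ∀ i : Fin (d + 1) → Fin n, Function.Injective i →
      HasSecondMomentLE (kernelAt (X n) (h n) i) (B n) (P n))
    (hK : ∀ᶠ n in atTop, HasVonMisesMomentLE (P n) (X n) (h n) K)
    (hlim₁ : Tendsto (fun n : ℕ => sharedWeight (a n) 1 *
      (u n * (crossGap (P n) (X n) (h n) + (n : ℝ)⁻¹))) atTop (𝓝 0))
    (hlimB : Tendsto (fun n => sharedWeight (a n) 2 * (u n * B n)) atTop (𝓝 0))
    (hlimn : Tendsto (fun n : ℕ => sharedWeight (a n) 2 * (u n * (n : ℝ)⁻¹)) atTop (𝓝 0)) :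
    Tendsto (fun z : Σ n, Ω n => u z.1 *
      projGap (laws (P z.1) (X z.1)) (a z.1) (h z.1) fun t => X z.1 t z.2)
      (highProb P) (𝓝 0) := by
  set κ : ℝ := 8 * ((d : ℝ) + 1) ^ 2 * (4 * K)
  have hlim := (hlim₁.const_mul (2 + κ)).add
    ((hlimB.const_mul (4 * ((d : ℝ) + 1) ^ 2)).add (hlimn.const_mul (((d : ℝ) + 1) ^ 2 * κ)))
  simp only [mul_zero, add_zero] at hlim
  refine tendsto_highProb_zero_of_integral_le (Z := fun n ω => u n *
    projGap (laws (P n) (X n)) (a n) (h n) fun t => X n t ω)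
    (fun n ω => mul_nonneg (hu n) (projGap_nonneg _ _ _ _)) ?_ hlim
  filter_upwards [hB, hK, eventually_gt_atTop 0, eventually_nonneg_of_hasSecondMomentLE hB]
    with n hBn hKn hn hB₀
  have : NeZero n := ⟨hn.ne'⟩
  refine ⟨(integrable_projGap (a n) (hh n) hKn).const_mul _, ?_⟩
  rw [integral_const_mul]
  have hκ : 0 ≤ κ := by have := (hKn.kernelAt fun _ => 0).nonneg; positivity
  have hgap := crossGap_nonneg (P := P n) (X := X n) (h n)
  have hcross : 2 * crossGap (P n) (X n) (h n) + κ * (n : ℝ)⁻¹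
      ≤ (2 + κ) * (crossGap (P n) (X n) (h n) + (n : ℝ)⁻¹) := by
    have := mul_nonneg hκ hgap
    linarith [inv_nonneg.2 (Nat.cast_nonneg (α := ℝ) n)]
  calc _ ≤ u n * ((2 + κ) * (crossGap (P n) (X n) (h n) + (n : ℝ)⁻¹) * sharedWeight (a n) 1
        + (d + 1) ^ 2 * (4 * B n + κ * (n : ℝ)⁻¹) * sharedWeight (a n) 2) :=
        mul_le_mul_of_nonneg_left ((integral_projGap_le (hX n) (hindep n) (hh n) (a n) hB₀ hBn
          hKn).trans (add_le_add_left (mul_le_mul_of_nonneg_right hcross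
            (sharedWeight_nonneg _ _)) _)) (hu n)
    _ = _ := by ring

lemma tendsto_sharedWeight_two_mul_sigma_inv (hX : ∀ n i, Measurable (X n i))
    (hindep : ∀ n, iIndepFun (X n) (P n)) (hh : ∀ n, Measurable (h n))
    (hB : ∀ᶠ n in atTop, ∀ i : Fin (d + 1) → Fin n, Function.Injective i →
      HasSecondMomentLE (kernelAt (X n) (h n) i) (B n) (P n))
    (hV : ∀ᶠ n in atTop, 0 < mainVar (P n) (X n) (a n) (h n))
    (hlim : Tendsto (fun n => sharedWeight (a n) 2 * ((mainVar (P n) (X n) (a n) (h n))⁻¹ * B n))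
      atTop (𝓝 0)) :
    Tendsto (fun n => sharedWeight (a n) 2 * ((sigma (P n) (X n) (a n) (h n) ^ 2)⁻¹ * B n))
      atTop (𝓝 0) := by
  have hratio := (tendsto_sigma_sq_div_mainVar hX hindep hh hB hV hlim).inv₀ one_ne_zero
  have hprod := hlim.mul hratio
  rw [zero_mul] at hprod
  refine hprod.congr' ?_
  filter_upwards [hV] with n hVn
  rw [inv_div]
  field_simp

lemma eventually_sigma_sq_ne_zero (hX : ∀ n i, Measurable (X n i))
    (hindep : ∀ n, iIndepFun (X n) (P n)) (hh : ∀ n, Measurable (h n))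
    (hB : ∀ᶠ n in atTop, ∀ i : Fin (d + 1) → Fin n, Function.Injective i →
      HasSecondMomentLE (kernelAt (X n) (h n) i) (B n) (P n))
    (hV : ∀ᶠ n in atTop, 0 < mainVar (P n) (X n) (a n) (h n))
    (hlim : Tendsto (fun n => sharedWeight (a n) 2 * ((mainVar (P n) (X n) (a n) (h n))⁻¹ * B n))
      atTop (𝓝 0)) : ∀ᶠ n in atTop, sigma (P n) (X n) (a n) (h n) ^ 2 ≠ 0 := by
  filter_upwards [(tendsto_sigma_sq_div_mainVar hX hindep hh hB hV hlim).eventually_ne one_ne_zero]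
    with n hn hσ
  exact hn (by rw [hσ, zero_div])

lemma abs_mul_variance_uStat_bootstrapLaw_sub_one_le {n : ℕ} [NeZero n] (Q : Fin n → Measure 𝒳)
    [∀ t, IsProbabilityMeasure (Q t)] (a : (Fin (d + 1) → Fin n) → ℝ)
    {h : (Fin (d + 1) → 𝒳) → ℝ} (hh : Measurable h) (x : Fin n → 𝒳) {s : ℝ} (hs : 0 ≤ s) :
    |s * Var[uStat a h; bootstrapLaw x] - 1|
      ≤ (1 + (d + 1) ^ 2) * (s * (meanSqKernel h x * sharedWeight a 2))
        + (s * projGap Q a h x + 2 * √(s * projGap Q a h x * (s * bootProjVar Q a h x)))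
        + |s * bootProjVar Q a h x - 1| := by
  have hG : 0 ≤ bootProjVar Q a h x := variance_nonneg _ _
  have hgap := bootProjGap_le_projGap Q a hh x
  have hboot : |Var[uStat a h; bootstrapLaw x] - bootProjVar Q a h x|
      ≤ (1 + (d + 1) ^ 2) * meanSqKernel h x * sharedWeight a 2
        + (projGap Q a h x + 2 * √(projGap Q a h x * bootProjVar Q a h x)) :=
    (abs_variance_uStat_bootstrapLaw_sub_bootProjVar_le Q a hh x).trans (by gcongr)
  have hsqrt : √(s * projGap Q a h x * (s * bootProjVar Q a h x))
      = s * √(projGap Q a h x * bootProjVar Q a h x) := by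
    rw [mul_mul_mul_comm, Real.sqrt_mul (mul_self_nonneg s), Real.sqrt_mul_self hs]
  refine (abs_sub_le _ (s * bootProjVar Q a h x) _).trans (add_le_add_left ?_ _)
  rw [← mul_sub, abs_mul, abs_of_nonneg hs, hsqrt]
  exact (mul_le_mul_of_nonneg_left hboot hs).trans_eq (by ring)

lemma tendsto_highProb_variance_bootstrapLaw (hX : ∀ n i, Measurable (X n i))
    (hh : ∀ n, Measurable (h n)) (hu : ∀ n, 0 ≤ u n)
    (hmean : Tendsto (fun z : Σ n, Ω n => u z.1 *
      (meanSqKernel (h z.1) (fun t => X z.1 t z.2) * sharedWeight (a z.1) 2))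
      (highProb P) (𝓝 0))
    (hgap : Tendsto (fun z : Σ n, Ω n => u z.1 *
      projGap (laws (P z.1) (X z.1)) (a z.1) (h z.1) fun t => X z.1 t z.2) (highProb P) (𝓝 0))
    (hproj : Tendsto (fun z : Σ n, Ω n => u z.1 *
      bootProjVar (laws (P z.1) (X z.1)) (a z.1) (h z.1) fun t => X z.1 t z.2)
      (highProb P) (𝓝 1)) :
    Tendsto (fun z : Σ n, Ω n => u z.1 *
      Var[uStat (a z.1) (h z.1); bootstrapLaw fun t => X z.1 t z.2]) (highProb P) (𝓝 1) := by
  have hbound := ((hmean.const_mul (1 + ((d : ℝ) + 1) ^ 2)).add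
    (hgap.add ((hgap.mul hproj).sqrt.const_mul 2))).add (hproj.sub_const 1).abs
  simp only [mul_zero, zero_mul, Real.sqrt_zero, sub_self, abs_zero, add_zero] at hbound
  refine tendsto_iff_dist_tendsto_zero.2 (squeeze_zero' (.of_forall fun _ => dist_nonneg) ?_ hbound)
  filter_upwards [tendsto_fst_highProb.eventually (eventually_gt_atTop 0)] with z hz
  have : NeZero z.1 := ⟨hz.ne'⟩
  have := fun t => isProbabilityMeasure_laws (P := P z.1) (hX z.1) t
  exact abs_mul_variance_uStat_bootstrapLaw_sub_one_le _ _ (hh z.1) _ (hu z.1)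

end Asymptotics

end WeightedU

end

theorem mainTheorem3_general
    {𝒳 : Type*} [MeasurableSpace 𝒳]
    {Ω : ℕ → Type*} [∀ n, MeasurableSpace (Ω n)]
    (P : ∀ n, Measure (Ω n)) [∀ n, IsProbabilityMeasure (P n)]
    (X : ∀ n, Fin n → Ω n → 𝒳) (hX : ∀ n i, Measurable (X n i))
    (hindep : ∀ n, iIndepFun (X n) (P n))
    (d : ℕ) (a : ∀ n, (Fin (d + 1) → Fin n) → ℝ)
    (h : ℕ → (Fin (d + 1) → 𝒳) → ℝ) (hh : ∀ n, Measurable (h n))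
    (B : ℕ → ℝ)
    (hB : ∀ᶠ n in atTop, ∀ i : Fin (d + 1) → Fin n, Function.Injective i →
      HasSecondMomentLE (kernelAt (X n) (h n) i) (B n) (P n))
    (hV : ∀ᶠ n in atTop, 0 < mainVar (P n) (X n) (a n) (h n))
    (hclt : Tendsto (fun n : ℕ => (n : ℝ) ^ (-2 : ℝ) * mainVar (P n) (X n) (a n) (h n) ^ (-1 : ℝ)
      * avgWeight (a n) 2 2 * B n) atTop (𝓝 0))
    (K : ℝ) (hK : ∀ᶠ n in atTop, HasVonMisesMomentLE (P n) (X n) (h n) K)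
    (hhomo₁ : TendstoInProb P (fun n ω => (1 / (n : ℝ)) * ∑ i, ∑ j,
      (h1 (laws (P n) (X n)) (a n) (h n) i (X n j ω)
        / (n * sigma (P n) (X n) (a n) (h n))) ^ 2) 1)
    (hhomo₂ : TendstoInProb P (fun n ω => (1 / (n : ℝ) ^ 2) * ∑ i, (∑ j,
      h1 (laws (P n) (X n)) (a n) (h n) i (X n j ω)
        / (n * sigma (P n) (X n) (a n) (h n))) ^ 2) 0)
    (hhet : Tendsto (fun n : ℕ => (n : ℝ)⁻¹ * (sigma (P n) (X n) (a n) (h n) ^ 2)⁻¹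
      * avgWeight (a n) 2 1 * (crossGap (P n) (X n) (h n) + (n : ℝ)⁻¹)) atTop (𝓝 0)) :
    TendstoInProb P (fun n ω =>
      |Var[fun x => (sigma (P n) (X n) (a n) (h n))⁻¹ * uStat (a n) (h n) x;
          bootstrapLaw fun i => X n i ω]
        - Var[fun ω' => (sigma (P n) (X n) (a n) (h n))⁻¹
          * uStat (a n) (h n) (fun i => X n i ω'); P n]|) 0 := by
  set u : ℕ → ℝ := fun n => (sigma (P n) (X n) (a n) (h n) ^ 2)⁻¹
  have hu : ∀ n, 0 ≤ u n := fun n => inv_nonneg.2 (sq_nonneg _)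
  have hlimV := tendsto_sharedWeight_two_mul_mainVar_inv hB hV hclt
  have hlimB := tendsto_sharedWeight_two_mul_sigma_inv hX hindep hh hB hV hlimV
  have hlim₁ := tendsto_sharedWeight_one_mul hu hhet
  have hlimn := tendsto_sharedWeight_two_mul_inv hu hlim₁
  have hmean := tendsto_highProb_meanSqKernel hu hB (hK.mono fun _ hn => hn.kernelAt) hlimB hlimn
  have hgap := tendsto_highProb_projGap hX hindep hh hu hB hK hlim₁ hlimB hlimn
  have hproj := tendsto_highProb_bootProjVar hX hh hhomo₁ hhomo₂
  rw [sub_zero] at hproj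
  have hboot := tendsto_highProb_variance_bootstrapLaw hX hh hu hmean hgap hproj
  have hσ := eventually_sigma_sq_ne_zero hX hindep hh hB hV hlimV
  have hdiff := (hboot.sub_const 1).abs
  rw [sub_self, abs_zero] at hdiff
  refine tendstoInProb_iff_tendsto.2 (hdiff.congr' ?_)
  filter_upwards [tendsto_fst_highProb.eventually hσ] with z hz
  rw [variance_sigma_inv_mul_uStat hz, variance_const_mul, inv_pow]

theorem mainTheorem3
    {𝒳 : Type*} [MeasurableSpace 𝒳]
    -- a triangular array of row-wise independent random variables
    {Ω : ℕ → Type*} [∀ n, MeasurableSpace (Ω n)]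
    (P : ∀ n, Measure (Ω n)) [∀ n, IsProbabilityMeasure (P n)]
    (X : ∀ n, Fin n → Ω n → 𝒳) (hX : ∀ n i, Measurable (X n i))
    (hindep : ∀ n, iIndepFun (X n) (P n))
    -- weights and kernels of degree `m = d + 1`
    (d : ℕ) (a : ∀ n, (Fin (d + 1) → Fin n) → ℝ)
    (h : ℕ → (Fin (d + 1) → 𝒳) → ℝ) (hh : ∀ n, Measurable (h n))
    -- the conditions of the central limit theorem
    (M : ℕ → ℝ) (hM : ∀ n, 0 < M n)
    (hmoment : ∀ n, ∀ i ∈ distinctTuples n (d + 1),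
      ∫⁻ ω, ENNReal.ofReal (h n (fun l => X n (i l) ω) ^ 4) ∂P n ≤ ENNReal.ofReal (M n))
    (hV : ∀ᶠ n in atTop, 0 < mainVar (P n) (X n) (a n) (h n))
    (hclt₁ : Tendsto (fun n : ℕ => (n : ℝ) ^ (-2 : ℝ) * mainVar (P n) (X n) (a n) (h n) ^ (-1 : ℝ)
      * avgWeight (a n) 2 2 * M n ^ (1 / 2 : ℝ)) atTop (𝓝 0))
    (hclt₂ : Tendsto (fun n : ℕ => (n : ℝ) ^ (-2 : ℝ)
      * mainVar (P n) (X n) (a n) (h n) ^ (-(3 / 2) : ℝ)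
      * avgWeight (a n) 3 1 * M n ^ (3 / 4 : ℝ)) atTop (𝓝 0))
    -- (i) bounded second moments, repeated indices standing for the same random variable ...
    (hvonMises : limsup (fun n => ⨆ i : Fin (d + 1) → Fin n,
      ∫⁻ ω, ENNReal.ofReal (h n (fun l => X n (i l) ω) ^ 2) ∂P n) atTop < ⊤)
    -- ... and when an independent copy of some `X_j` is inserted among distinct `X_{i_k}`
    (hcopy : limsup (fun n => ⨆ (l : Fin (d + 1)) (j : Fin n) (i ∈ distinctTuples n d),
      ∫⁻ x, ∫⁻ y : Fin d → 𝒳, ENNReal.ofReal (h n (l.insertNth x y) ^ 2)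
        ∂(Measure.pi fun k => laws (P n) (X n) (i k)) ∂(laws (P n) (X n) j)) atTop < ⊤)
    -- (ii) control of heterogeneity
    (hhomo₁ : TendstoInProb P (fun n ω => (1 / (n : ℝ)) * ∑ i, ∑ j,
      (h1 (laws (P n) (X n)) (a n) (h n) i (X n j ω)
        / (n * sigma (P n) (X n) (a n) (h n))) ^ 2) 1)
    (hhomo₂ : TendstoInProb P (fun n ω => (1 / (n : ℝ) ^ 2) * ∑ i, (∑ j,
      h1 (laws (P n) (X n)) (a n) (h n) i (X n j ω)
        / (n * sigma (P n) (X n) (a n) (h n))) ^ 2) 0)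
    (hhet : Tendsto (fun n : ℕ => (n : ℝ)⁻¹ * (sigma (P n) (X n) (a n) (h n) ^ 2)⁻¹
      * avgWeight (a n) 2 1
      * (meanGap (P n) (X n) (h n) ^ 2 + crossGap (P n) (X n) (h n) + (n : ℝ)⁻¹)) atTop (𝓝 0)) :
    TendstoInProb P (fun n ω =>
      |Var[fun x => (sigma (P n) (X n) (a n) (h n))⁻¹ * uStat (a n) (h n) x;
          bootstrapLaw fun i => X n i ω]
        - Var[fun ω' => (sigma (P n) (X n) (a n) (h n))⁻¹
          * uStat (a n) (h n) (fun i => X n i ω'); P n]|) 0 := by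
  obtain ⟨K, hK⟩ := exists_eventually_hasVonMisesMomentLE hX hh hvonMises hcopy
  refine mainTheorem3_general P X hX hindep d a h hh (fun n => M n ^ (1 / 2 : ℝ))
    (.of_forall fun n i hi => ?_) hV hclt₁ K hK hhomo₁ hhomo₂
    (tendsto_mul_crossGap_of_meanGap (fun n => ?_) hhet)
  · rw [← Real.sqrt_eq_rpow]
    exact hasSecondMomentLE_sqrt_of_lintegral_pow_four_le
      (measurable_kernelAt (hX n) (hh n) i).aestronglyMeasurable (hM n).le
      (hmoment n i (mem_distinctTuples.2 hi))
  · have := avgWeight_nonneg (a n) 2 1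
    positivity
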